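/- Let $\ell$ be a prime and let $K_v$ be a field complete for a discrete valuation $v$ (normalised so that $v(K_v^*)=\mathbb{Z}$), with perfect residue field of characteristic $\ell$, and with finite absolute ramification index $e=v(\ell)$. Let $K_\infty/K_v$ be a totally ramified Galois extension with $\mathscr{C}=\mathrm{Gal}(K_\infty/K_v)\simeq\mathbb{Z}_\ell$ (as topological groups), and let $X$ be the completion of $K_\infty$ for the absolute value associated with $v$, with the action of $\mathscr{C}$ extended by continuity. For a continuous character $\chi:\mathscr{C}\to K_v^*$ let $X(\chi)$ be $X$ with the twisted action $\tau\cdot x=\chi(\tau)\tau(x)$. Let $H^0(\mathscr{C},X(\chi))$ be the space of elements fixed by this action, and $H^1(\mathscr{C},X(\chi))$ the quotient of the continuous maps $f:\mathscr{C}\to X$ with $f(\tau\tau')=\tau\cdot f(\tau')+f(\tau)$ by those of the form $\tau\mapsto\tau\cdot a-a$ with $a\in X$. Put $$c_6:=2+\left[\frac{1}{e\ell(\ell-1)}+\frac{2\ell e}{(\ell-1)^2}+\frac{\log(2e)}{\log\ell}\right],$$ where $[\,\cdot\,]$ is the integer part. Then $c_6\le 7e$, and for every continuous character $\chi:\mathscr{C}\to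 K_v^*$ with $\chi^{\ell^{c_6}}\neq 1$ one has $H^0(\mathscr{C},X(\chi))=0$ and $H^1(\mathscr{C},X(\chi))=0$. -/

import Mathlib

open scoped NormedField

noncomputable section

/-! ### Continuous cohomology in degrees 0 and 1 -/

section Cohomology

variable {K G A : Type*} [Field K] [Group G] [TopologicalSpace G] [AddCommGroup A] [Module K A]
  [TopologicalSpace A] [IsTopologicalAddGroup A] [ContinuousConstSMul K A]

/-- `H⁰(G, A)`: the elements of `A` fixed by `G`. -/
def contH0 (ρ : Representation K G A) : Submodule K A := ρ.invariants

/-- Continuous 1-cocycles: continuous `f : G → A` with `f (g h) = g • f h + f g`. -/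
def contZ1 (ρ : Representation K G A) : Submodule K (G → A) where
  carrier := {f | Continuous f ∧ ∀ g h, f (g * h) = ρ g (f h) + f g}
  zero_mem' := ⟨continuous_const, by simp⟩
  add_mem' := by
    rintro f f' ⟨hf, hf'⟩ ⟨kf, kf'⟩
    refine ⟨hf.add kf, fun g h => ?_⟩
    simp only [Pi.add_apply, hf', kf', map_add]
    abel
  smul_mem' := by
    rintro c f ⟨hf, hf'⟩
    refine ⟨hf.const_smul c, fun g h => ?_⟩
    simp only [Pi.smul_apply, hf', map_smul, smul_add]

/-- 1-coboundaries: the cocycles of the form `g ↦ g • a - a`. -/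
def contB1 (ρ : Representation K G A) : Submodule K (contZ1 ρ) where
  carrier := {f | ∃ a : A, ∀ g, f.1 g = ρ g a - a}
  zero_mem' := ⟨0, by simp⟩
  add_mem' := by
    rintro f f' ⟨a, ha⟩ ⟨b, hb⟩
    refine ⟨a + b, fun g => ?_⟩
    simp only [Submodule.coe_add, Pi.add_apply, ha, hb, map_add]
    abel
  smul_mem' := by
    rintro c f ⟨a, ha⟩
    refine ⟨c • a, fun g => ?_⟩
    simp only [Submodule.coe_smul, Pi.smul_apply, ha, map_smul, smul_sub]

/-- `H¹(G, A)`: continuous cocycles modulo coboundaries. -/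
abbrev contH1 (ρ : Representation K G A) : Type _ := contZ1 ρ ⧸ contB1 ρ

end Cohomology

/-- The twist `V(χ)` of a representation on `V` by a character `χ`:
`τ • x = χ(τ) τ(x)`. -/
def twistRep {K G V : Type*} [Field K] [Group G] [AddCommGroup V] [Module K V]
    (ρ : Representation K G V) (χ : G →* Kˣ) : Representation K G V where
  toFun τ := (χ τ : K) • ρ τ
  map_one' := by simp
  map_mul' σ τ := by
    ext x
    simp [smul_smul, mul_comm]

/-! ### The completion of an algebraic extension and its Galois action -/

section Completion

variable (K L : Type*) [NontriviallyNormedField K] [IsUltrametricDist K] [CompleteSpace K]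
  [NormedField L] [NormedAlgebra K L] [Algebra.IsAlgebraic K L]

theorem continuous_gal (τ : Gal(L/K)) : Continuous (τ : L → L) := by
  have h : ∀ x : L, ‖τ x‖ = ‖x‖ := fun x => by
    rw [NormedAlgebra.norm_eq_spectralNorm K, NormedAlgebra.norm_eq_spectralNorm K,
      ← spectralNorm_eq_of_equiv τ x]
  exact (AddMonoidHomClass.isometry_of_norm τ h).continuous

/-- The action of `Gal(L/K)` on the completion `X` of `L`, by extension by continuity. -/
def completionRep : Representation K Gal(L/K) (UniformSpace.Completion L) where
  toFun τ :=
    { toFun := UniformSpace.Completion.mapRingHom (τ : L →+* L) (continuous_gal K L τ)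
      map_add' := map_add _
      map_smul' := fun c x => by
        simp only [Algebra.smul_def, map_mul, RingHom.id_apply]
        congr 1
        rw [UniformSpace.Completion.algebraMap_def]
        refine (UniformSpace.Completion.mapRingHom_coe _ _).trans ?_
        simp }
  map_one' := by
    ext x
    exact congrArg (fun f => f x) (UniformSpace.Completion.mapRingHom_id (α := L))
  map_mul' σ τ := by
    ext x
    exact congrArg (fun f => f x) (UniformSpace.Completion.mapRingHom_comp
      (f := (τ : L →+* L)) (g := (σ : L →+* L)) (continuous_gal K L σ)
      (continuous_gal K L τ)).symm

theorem completionRep_coe (τ : Gal(L/K)) (x : L) :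
    completionRep K L τ (x : UniformSpace.Completion L) = ((τ x : L) : UniformSpace.Completion L) :=
  UniformSpace.Completion.mapRingHom_coe (f := (τ : L →+* L)) (continuous_gal K L τ) x

theorem continuous_completionRep (τ : Gal(L/K)) : Continuous (completionRep K L τ) :=
  UniformSpace.Completion.continuous_map

end Completion

/-! ### Total ramification -/

section Ramification

variable (K L : Type*) [NormedField K] [NormedField L] [NormedAlgebra K L]

/-- The value group `|F^*|` of an intermediate field `F`, as a subgroup of `ℝˣ`. -/
def valueGroupOf (F : IntermediateField K L) : Subgroup ℝˣ :=
  ((Units.map (normHom : L →*₀ ℝ).toMonoidHom).comp (Units.map (F.val : F →* L))).range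

/-- The ramification index `(|F^*| : |K^*|)` of an intermediate field `F` over `K`
(the value is `0` if the index is infinite). -/
def ramIndexOf (F : IntermediateField K L) : ℕ :=
  (valueGroupOf K L ⊥).relIndex (valueGroupOf K L F)

/-- `L/K` is totally ramified: every finite subextension has ramification index equal to
its degree. -/
def IsTotRamified : Prop :=
  ∀ F : IntermediateField K L, FiniteDimensional K F → ramIndexOf K L F = Module.finrank K F

end Ramification

/-- The constant `2 + [1 / (e ℓ (ℓ - 1)) + 2 ℓ e / (ℓ - 1)² + log (2 e) / log ℓ]`. -/
def cSix (ℓ e : ℕ) : ℕ :=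
  2 + ⌊1 / ((e : ℝ) * ℓ * ((ℓ : ℝ) - 1)) + 2 * (ℓ : ℝ) * e / ((ℓ : ℝ) - 1) ^ 2
    + Real.log (2 * (e : ℝ)) / Real.log (ℓ : ℝ)⌋₊

end

/-! ### Ultrametric estimates -/

section Ultrametric

variable {R : Type*} [NormedField R] [IsUltrametricDist R]

/-! Let `γ` be a topological generator of the Galois group, `u = χ γ`, and `R = u γ` on the
completion. A fixed vector is killed by `R - 1`, and a continuous cocycle is determined by its value
at `γ`, because the powers of `γ` are dense. So both cohomology groups vanish once `R - 1` is
bijective. As `R - 1` is a factor of `R ^ ℓ ^ n - 1` on either side, it suffices that `S = m s - 1`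
is bijective, where `n = cSix ℓ e`, `m = u ^ ℓ ^ n` and `s = γ ^ ℓ ^ n`. Here `u` is a principal
unit, the size of `n` forces `|m - 1| < |ℓ|`, and the hypothesis on `χ` gives `m ≠ 1`.

The heart is an estimate `|x| ≤ C |S x|` on the uncompleted field
(`exists_norm_le_mul_norm_twist_sub`). On layer `n` the operator `S` is multiplication by `m - 1`.
Going from layer `N` to `N + 1`, write `x = x' + y` with `x'` the normalised trace of `x` and `y` of
trace zero. Induction handles `x'`. For `y`, if `τ` generates the step then `|ℓ| |y| ≤ |τ y - y|`;
since `τ` is a power of `s`, this difference is controlled by `S y` up to an error `|m - 1| |y|`,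
too small to matter. Each step costs the norm `D N` of a normalised trace. Given the estimate, `S`
is injective with closed range, and it is onto on each finite-dimensional layer, so it is bijective
on the completion.

It remains to bound the product of the `D N`. If `B` is the break of a step, so that `|τ x - x| ≤ B
|x|`, then expanding the trace in powers of `τ - 1` bounds it by `max (B ^ (ℓ - 1)) |ℓ|`. A
comparison of consecutive breaks (`break_succ_le`) shows that the logarithmic excess of `B ^ (ℓ -
1)` over `|ℓ|` decays geometrically along the tower, so its sum is finite. -/

theorem norm_one_add_pow_prime_sub_le {ℓ : ℕ} (hℓ : ℓ.Prime) {h : R} (hh : ‖h‖ ≤ 1) :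
    ‖(1 + h) ^ ℓ - 1 - h ^ ℓ‖ ≤ ‖(ℓ : R)‖ * ‖h‖ := by
  rw [add_pow_prime_eq hℓ]
  have : ((1 : R) ^ ℓ + h ^ ℓ + (ℓ : R) * 1 * h * ∑ k ∈ Finset.Ioo 0 ℓ,
      1 ^ (k - 1) * h ^ (ℓ - k - 1) * ((ℓ.choose k / ℓ : ℕ) : R)) - 1 - h ^ ℓ
      = (ℓ : R) * h * ∑ k ∈ Finset.Ioo 0 ℓ,
      1 ^ (k - 1) * h ^ (ℓ - k - 1) * ((ℓ.choose k / ℓ : ℕ) : R) := by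
    rw [one_pow]; ring
  rw [this, norm_mul, norm_mul]
  refine mul_le_of_le_one_right (by positivity) ?_
  refine IsUltrametricDist.norm_sum_le_of_forall_le_of_nonneg zero_le_one fun k _ => ?_
  rw [one_pow, one_mul, norm_mul, norm_pow]
  exact mul_le_one₀ (pow_le_one₀ (norm_nonneg _) hh) (norm_nonneg _)
    (IsUltrametricDist.norm_natCast_le_one R _)

theorem norm_sub_le_max (x y : R) : ‖x - y‖ ≤ max ‖x‖ ‖y‖ := by
  rw [sub_eq_add_neg, ← norm_neg y]
  exact IsUltrametricDist.norm_add_le_max _ _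

theorem norm_eq_of_norm_sub_lt {x y : R} (h : ‖x - y‖ < ‖y‖) : ‖x‖ = ‖y‖ := by
  have := IsUltrametricDist.norm_add_eq_max_of_norm_ne_norm h.ne
  rw [sub_add_cancel, max_eq_right h.le] at this
  exact this

/-- Modulo the maximal ideal `y ^ ℓ - 1` is `(y - 1) ^ ℓ`: the residue characteristic is `ℓ`, and
Frobenius is injective there. -/
theorem norm_sub_one_lt_of_norm_pow_sub_one_lt {ℓ : ℕ} (hℓ : ℓ.Prime) (hl : ‖(ℓ : R)‖ < 1) {x : R}
    (hx : ‖x‖ = 1) (m : ℕ) (h : ‖x ^ ℓ ^ m - 1‖ < 1) : ‖x - 1‖ < 1 := by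
  induction m with
  | zero => simpa using h
  | succ m ih =>
    apply ih
    set y := x ^ ℓ ^ m with hy
    have hyn : ‖y‖ = 1 := by rw [hy, norm_pow, hx, one_pow]
    have hle : ‖y - 1‖ ≤ 1 := (norm_sub_le_max _ _).trans (by simp [hyn])
    have h1 := norm_one_add_pow_prime_sub_le hℓ hle
    have h2 : x ^ ℓ ^ (m + 1) = y ^ ℓ := by rw [hy, ← pow_mul, pow_succ]
    rw [h2] at h
    rw [add_sub_cancel] at h1
    have h3 : ‖(y - 1) ^ ℓ‖ < 1 := by
      have : (y - 1) ^ ℓ = (y ^ ℓ - 1) - (y ^ ℓ - 1 - (y - 1) ^ ℓ) := by ring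
      rw [this]
      refine (norm_sub_le_max _ _).trans_lt (max_lt h (h1.trans_lt ?_))
      exact (mul_le_of_le_one_right (norm_nonneg _) hle).trans_lt hl
    rw [norm_pow] at h3
    exact (pow_lt_one_iff_of_nonneg (norm_nonneg _) hℓ.ne_zero).1 h3

/-- Raising `1 + h` to the power `ℓ` replaces `h` by `h ^ ℓ` plus a term of size at most `|ℓ| |h|`,
so the distance to one shrinks like `q ^ ℓ ^ n` until it reaches `|ℓ|`. -/
theorem norm_pow_prime_pow_sub_one_le {ℓ : ℕ} (hℓ : ℓ.Prime) {q : ℝ} (hq1 : q ≤ 1) {x : R}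
    (hx : ‖x - 1‖ ≤ q) (n : ℕ) : ‖x ^ ℓ ^ n - 1‖ ≤ max (q ^ ℓ ^ n) ‖(ℓ : R)‖ := by
  have hq0 : 0 ≤ q := (norm_nonneg _).trans hx
  have hl1 : ‖(ℓ : R)‖ ≤ 1 := IsUltrametricDist.norm_natCast_le_one R _
  induction n with
  | zero => simpa using Or.inl hx
  | succ n ih =>
    set h := x ^ ℓ ^ n - 1 with hh
    have hle : ‖h‖ ≤ 1 := ih.trans (max_le (pow_le_one₀ hq0 hq1) hl1)
    have h1 := norm_one_add_pow_prime_sub_le hℓ hle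
    have h2 : x ^ ℓ ^ (n + 1) - 1 = ((1 + h) ^ ℓ - 1 - h ^ ℓ) + h ^ ℓ := by
      rw [hh, add_sub_cancel, pow_succ, pow_mul]; ring
    rw [h2]
    refine (IsUltrametricDist.norm_add_le_max _ _).trans (max_le ?_ ?_)
    · exact (h1.trans (mul_le_of_le_one_right (norm_nonneg _) hle)).trans (le_max_right _ _)
    · rw [norm_pow]
      refine (pow_le_pow_left₀ (norm_nonneg _) ih ℓ).trans ?_
      rcases le_total (q ^ ℓ ^ n) ‖(ℓ : R)‖ with h | h
      · rw [max_eq_right h]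
        exact (pow_le_of_le_one (norm_nonneg _) hl1 hℓ.ne_zero).trans (le_max_right _ _)
      · rw [max_eq_left h, ← pow_mul, ← pow_succ]
        exact le_max_left _ _

end Ultrametric

/-! ### Sums over the powers of an automorphism -/

section GalTrace

variable {K L : Type*} [Field K] [NormedField L] [Algebra K L]

/-- A Galois automorphism as a linear endomorphism. -/
abbrev galEnd (s : Gal(L/K)) : Module.End K L := s.toLinearMap

theorem galEnd_pow (s : Gal(L/K)) (n : ℕ) : galEnd (s ^ n) = galEnd s ^ n :=
  map_pow (AlgEquiv.toLinearMapHom K L) s n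

/-- The operator `1 + s + ⋯ + s ^ (n - 1)`. -/
def galTrace (n : ℕ) (s : Gal(L/K)) : Module.End K L := ∑ j ∈ Finset.range n, galEnd s ^ j

theorem galTrace_apply (n : ℕ) (s : Gal(L/K)) (x : L) :
    galTrace n s x = ∑ j ∈ Finset.range n, (s ^ j) x := by
  simp only [galTrace, LinearMap.sum_apply, ← galEnd_pow]
  rfl

theorem galTrace_mul_sub_one (n : ℕ) (s : Gal(L/K)) :
    galTrace n s * (galEnd s - 1) = galEnd (s ^ n) - 1 := by
  rw [galEnd_pow, galTrace, geom_sum_mul]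

theorem sub_one_mul_galTrace (n : ℕ) (s : Gal(L/K)) :
    (galEnd s - 1) * galTrace n s = galEnd (s ^ n) - 1 := by
  rw [galEnd_pow, galTrace, mul_geom_sum]

/-- This is `((1 + T) ^ n - 1) / T` expanded at `T = s - 1`. -/
theorem galTrace_eq_sum_choose (n : ℕ) (s : Gal(L/K)) :
    galTrace n s = ∑ k ∈ Finset.range n, (n.choose (k + 1) : Module.End K L) * (galEnd s - 1) ^ k := by
  have h := congrArg (Polynomial.aeval (R := ℤ) (galEnd s - 1))
    (Polynomial.geom_sum_X_comp_X_add_one_eq_sum (R := ℤ) n)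
  rw [Polynomial.aeval_comp] at h
  simpa [galTrace, map_sum] using h

theorem galEnd_sub_one_apply (s : Gal(L/K)) (x : L) : (galEnd s - 1) x = s x - x := rfl

theorem galTrace_map_apply {s t : Gal(L/K)} (hst : Commute s t) (n : ℕ) (x : L) :
    galTrace n s (t x) = t (galTrace n s x) := by
  rw [galTrace_apply, galTrace_apply, map_sum]
  refine Finset.sum_congr rfl fun j _ => ?_
  exact congrArg (fun g : Gal(L/K) => g x) (hst.pow_left j).eq

theorem pow_map_mem {s : Gal(L/K)} {G : IntermediateField K L} (hG : ∀ x ∈ G, s x ∈ G) (j : ℕ)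
    {x : L} (hx : x ∈ G) : (s ^ j) x ∈ G := by
  induction j with
  | zero => simpa using hx
  | succ j ih => rw [pow_succ']; exact hG _ ih

theorem galTrace_mem {s : Gal(L/K)} {G : IntermediateField K L} (hG : ∀ x ∈ G, s x ∈ G) (n : ℕ)
    {x : L} (hx : x ∈ G) : galTrace n s x ∈ G := by
  rw [galTrace_apply]
  exact sum_mem fun j _ => pow_map_mem hG j hx

variable {s : Gal(L/K)} {G : IntermediateField K L} {B : ℝ}

theorem sub_one_pow_mem (hG : ∀ x ∈ G, s x ∈ G) (k : ℕ) {x : L} (hx : x ∈ G) :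
    ((galEnd s - 1) ^ k) x ∈ G := by
  induction k with
  | zero => simpa using hx
  | succ k ih =>
    rw [pow_succ', Module.End.mul_apply, galEnd_sub_one_apply]
    exact sub_mem (hG _ ih) ih

theorem norm_sub_one_pow_le (hG : ∀ x ∈ G, s x ∈ G) (hB0 : 0 ≤ B)
    (hB : ∀ x ∈ G, ‖s x - x‖ ≤ B * ‖x‖) (k : ℕ) {x : L} (hx : x ∈ G) :
    ‖((galEnd s - 1) ^ k) x‖ ≤ B ^ k * ‖x‖ := by
  induction k with
  | zero => simp
  | succ k ih =>
    rw [pow_succ', Module.End.mul_apply, galEnd_sub_one_apply, pow_succ', mul_assoc]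
    exact (hB _ (sub_one_pow_mem hG k hx)).trans (mul_le_mul_of_nonneg_left ih hB0)

/-- In the binomial expansion every coefficient except the last, which is one, is divisible by the
prime `ℓ`. -/
theorem norm_galTrace_sub_le [IsUltrametricDist L] {ℓ : ℕ} (hℓ : ℓ.Prime)
    (hG : ∀ x ∈ G, s x ∈ G) (hB0 : 0 ≤ B) (hB1 : B ≤ 1) (hB : ∀ x ∈ G, ‖s x - x‖ ≤ B * ‖x‖) {x : L} (hx : x ∈ G) :
    ‖galTrace ℓ s x - ((galEnd s - 1) ^ (ℓ - 1)) x‖ ≤ ‖(ℓ : L)‖ * ‖x‖ := by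
  obtain ⟨n, rfl⟩ : ∃ n, ℓ = n + 1 := ⟨ℓ - 1, by have := hℓ.one_lt; omega⟩
  rw [galTrace_eq_sum_choose, Finset.sum_range_succ, LinearMap.add_apply]
  simp only [Nat.choose_self, Nat.cast_one, one_mul, Nat.add_sub_cancel, add_sub_cancel_right]
  rw [LinearMap.sum_apply]
  refine IsUltrametricDist.norm_sum_le_of_forall_le_of_nonneg (by positivity) fun k hk => ?_
  obtain ⟨c, hc⟩ := hℓ.dvd_choose_self (Nat.succ_ne_zero k)
    (by have := Finset.mem_range.1 hk; omega)
  rw [Nat.succ_eq_add_one] at hc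
  rw [hc, Module.End.mul_apply, ← nsmul_one, LinearMap.smul_apply, Module.End.one_apply, nsmul_eq_mul,
    norm_mul, Nat.cast_mul, norm_mul]
  refine mul_le_mul (mul_le_of_le_one_right (norm_nonneg _)
    (IsUltrametricDist.norm_natCast_le_one L _)) ?_ (norm_nonneg _) (norm_nonneg _)
  exact (norm_sub_one_pow_le hG hB0 hB k hx).trans
    (mul_le_of_le_one_left (norm_nonneg _) (pow_le_one₀ hB0 hB1))

theorem norm_galTrace_le [IsUltrametricDist L] {ℓ : ℕ} (hℓ : ℓ.Prime) (hG : ∀ x ∈ G, s x ∈ G) (hB0 : 0 ≤ B)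
    (hB1 : B ≤ 1) (hB : ∀ x ∈ G, ‖s x - x‖ ≤ B * ‖x‖) {x : L} (hx : x ∈ G) :
    ‖galTrace ℓ s x‖ ≤ max (B ^ (ℓ - 1)) ‖(ℓ : L)‖ * ‖x‖ := by
  have h1 := norm_galTrace_sub_le hℓ hG hB0 hB1 hB hx
  have h2 := norm_sub_one_pow_le hG hB0 hB (ℓ - 1) hx
  rw [← sub_add_cancel (galTrace ℓ s x) (((galEnd s - 1) ^ (ℓ - 1)) x)]
  refine (IsUltrametricDist.norm_add_le_max _ _).trans (max_le (h1.trans ?_) (h2.trans ?_))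
  · exact mul_le_mul_of_nonneg_right (le_max_right _ _) (norm_nonneg _)
  · exact mul_le_mul_of_nonneg_right (le_max_left _ _) (norm_nonneg _)

theorem norm_pow_map_sub_le [IsUltrametricDist L] {ℓ : ℕ} (hℓ : ℓ.Prime)
    (hG : ∀ x ∈ G, s x ∈ G) (hB0 : 0 ≤ B) (hB1 : B ≤ 1) (hB : ∀ x ∈ G, ‖s x - x‖ ≤ B * ‖x‖) {x : L} (hx : x ∈ G) :
    ‖(s ^ ℓ) x - x‖ ≤ max (B ^ (ℓ - 1)) ‖(ℓ : L)‖ * (B * ‖x‖) := by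
  rw [← galEnd_sub_one_apply, ← galTrace_mul_sub_one, Module.End.mul_apply, galEnd_sub_one_apply]
  exact (norm_galTrace_le hℓ hG hB0 hB1 hB (sub_mem (hG x hx) hx)).trans
    (mul_le_mul_of_nonneg_left (hB x hx) (le_max_of_le_right (norm_nonneg _)))

/-- Additive Hilbert 90 for an automorphism of finite order with an element of trace one. -/
theorem exists_map_sub_eq_of_galTrace_eq_zero (hG : ∀ x ∈ G, s x ∈ G) {n : ℕ} {x z : L}
    (hxG : x ∈ G) (hzG : z ∈ G) (hxn : (s ^ n) x = x) (hx : galTrace n s x = 1)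
    (hz : galTrace n s z = 0) : ∃ w ∈ G, s w - w = z := by
  -- The identity `s (P i) = P (i + 1) - z`, with `P 0 = P n = 0`, makes `s` shift the sum of the `P
  -- i * (s ^ i) x` cyclically, up to `z` times the trace of `x`.
  set P : ℕ → L := fun i => ∑ j ∈ Finset.range i, (s ^ j) z with hP
  have hPs : ∀ i, s (P i) = P (i + 1) - z := fun i => by
    simp only [hP, map_sum]
    rw [Finset.sum_range_succ']
    simp [pow_succ']
  refine ⟨-∑ i ∈ Finset.range n, P i * (s ^ i) x, neg_mem (sum_mem fun i _ =>
    mul_mem (sum_mem fun j _ => pow_map_mem hG j hzG) (pow_map_mem hG i hxG)), ?_⟩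
  have h1 : s (∑ i ∈ Finset.range n, P i * (s ^ i) x)
      = ∑ i ∈ Finset.range n, P (i + 1) * (s ^ (i + 1)) x
        - z * ∑ i ∈ Finset.range n, (s ^ (i + 1)) x := by
    rw [map_sum, Finset.mul_sum, ← Finset.sum_sub_distrib]
    refine Finset.sum_congr rfl fun i _ => ?_
    rw [map_mul, hPs, pow_succ', AlgEquiv.mul_apply]
    ring
  have h2 := Finset.sum_range_succ' (fun i => P i * (s ^ i) x) n
  have h3 := Finset.sum_range_succ' (fun i => (s ^ i) x) n
  rw [Finset.sum_range_succ] at h2 h3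
  have hP0 : P 0 = 0 := by simp [hP]
  have hPn : P n = 0 := by rw [← hz, galTrace_apply]
  rw [galTrace_apply] at hx
  simp only [hP0, hPn, hxn, zero_mul, add_zero, pow_zero, AlgEquiv.one_apply] at h2 h3
  rw [map_neg, h1, ← h2, ← add_right_cancel h3, hx]
  ring

end GalTrace

/-! ### Totally ramified cyclic steps of prime degree -/

section Step

variable {K L : Type*} [Field K] [NormedField L] [Algebra K L]

/-- The set of absolute values of the elements of an intermediate field. -/
def normSet (E : IntermediateField K L) : Set ℝ := (fun x : L => ‖x‖) '' E

/-- `G / E` is a totally ramified cyclic extension of degree `ℓ` generated by `τ`: any element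
whose absolute value is new generates `G` over `E`, and absolute values of `G` have order `1` or
`ℓ` modulo those of `E`. -/
structure RamifiedStep (ℓ : ℕ) (τ : Gal(L/K)) (E G : IntermediateField K L) : Prop where
  le : E ≤ G
  pow_apply : ∀ x ∈ G, (τ ^ ℓ) x = x
  map_mem : ∀ x ∈ G, τ x ∈ G
  map_eq_iff : ∀ x ∈ G, τ x = x ↔ x ∈ E
  exists_gen : ∃ π ∈ G, ‖π‖ ∉ normSet E
  norm_pow_notMem : ∀ x ∈ G, ‖x‖ ∉ normSet E → ∀ j, 0 < j → j < ℓ → ‖x‖ ^ j ∉ normSet E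
  span : ∀ π ∈ G, ‖π‖ ∉ normSet E → ∀ y ∈ G,
    ∃ c : ℕ → L, (∀ i, c i ∈ E) ∧ y = ∑ i ∈ Finset.range ℓ, c i * π ^ i

/-- `B` is the multiplicative ramification break of the step `G / E` with generator `τ`. -/
structure IsBreak (τ : Gal(L/K)) (E G : IntermediateField K L) (B : ℝ) : Prop where
  norm_le : ∀ x ∈ G, ‖τ x - x‖ ≤ B * ‖x‖
  norm_eq : ∀ x ∈ G, ‖x‖ ∉ normSet E → ‖τ x - x‖ = B * ‖x‖

theorem norm_mem_normSet {E : IntermediateField K L} {x : L} (hx : x ∈ E) : ‖x‖ ∈ normSet E :=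
  ⟨x, hx, rfl⟩

theorem ne_zero_of_norm_notMem {E : IntermediateField K L} {x : L} (hx : ‖x‖ ∉ normSet E) :
    x ≠ 0 := by
  rintro rfl
  exact hx (norm_mem_normSet E.zero_mem)

theorem mul_mem_normSet {E : IntermediateField K L} {a b : ℝ} (ha : a ∈ normSet E)
    (hb : b ∈ normSet E) : a * b ∈ normSet E := by
  obtain ⟨x, hx, rfl⟩ := ha
  obtain ⟨y, hy, rfl⟩ := hb
  exact ⟨x * y, mul_mem hx hy, norm_mul _ _⟩

theorem inv_mem_normSet {E : IntermediateField K L} {a : ℝ} (ha : a ∈ normSet E) :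
    a⁻¹ ∈ normSet E := by
  obtain ⟨x, hx, rfl⟩ := ha
  exact ⟨x⁻¹, inv_mem hx, norm_inv _⟩

theorem pow_mem_normSet {E : IntermediateField K L} {a : ℝ} (ha : a ∈ normSet E) (k : ℕ) :
    a ^ k ∈ normSet E := by
  obtain ⟨x, hx, rfl⟩ := ha
  exact ⟨x ^ k, pow_mem hx k, norm_pow _ _⟩

theorem notMem_normSet_mul {E : IntermediateField K L} {a b : ℝ} (ha : a ∈ normSet E) (ha0 : a ≠ 0)
    (hb : b ∉ normSet E) : a * b ∉ normSet E := fun h => hb (by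
  have := mul_mem_normSet (inv_mem_normSet ha) h
  rwa [inv_mul_cancel_left₀ ha0] at this)

theorem norm_map_pow_sub_pow_le (s : Gal(L/K)) (hs : ∀ x, ‖s x‖ = ‖x‖) [IsUltrametricDist L]
    {A : ℝ} (hA : 0 ≤ A) {x : L} (hx : ‖s x - x‖ ≤ A * ‖x‖) (i : ℕ) :
    ‖s (x ^ i) - x ^ i‖ ≤ A * ‖x ^ i‖ := by
  induction i with
  | zero => simpa using hA
  | succ i ih =>
    have : s (x ^ (i + 1)) - x ^ (i + 1) = s (x ^ i) * (s x - x) + (s (x ^ i) - x ^ i) * x := by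
      rw [pow_succ, map_mul]; ring
    rw [this, pow_succ, norm_mul, ← mul_assoc]
    refine (IsUltrametricDist.norm_add_le_max _ _).trans (max_le ?_ ?_)
    · rw [norm_mul, hs]
      nlinarith [mul_le_mul_of_nonneg_left hx (norm_nonneg (x ^ i))]
    · rw [norm_mul]
      exact mul_le_mul_of_nonneg_right ih (norm_nonneg _)

theorem norm_mul_pow_ne {ℓ : ℕ} {E : IntermediateField K L} {π : L} (hπE : ‖π‖ ∉ normSet E)
    (hπ : ∀ j, 0 < j → j < ℓ → ‖π‖ ^ j ∉ normSet E) {a b : L} (ha : a ∈ E) (hb : b ∈ E) (ha0 : a ≠ 0) {i j : ℕ} (hij : i < j) (hj : j < ℓ) :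
    ‖a * π ^ i‖ ≠ ‖b * π ^ j‖ := by
  have hπ0 : ‖π‖ ≠ 0 := norm_ne_zero_iff.2 (ne_zero_of_norm_notMem hπE)
  intro heq
  rw [norm_mul, norm_mul, norm_pow, norm_pow] at heq
  have hb0 : ‖b‖ ≠ 0 := fun h0 => by
    rw [h0, zero_mul] at heq
    exact mul_ne_zero (norm_ne_zero_iff.2 ha0) (pow_ne_zero _ hπ0) heq
  refine hπ (j - i) (by omega) (by omega) ?_
  have hjj : ‖π‖ ^ j = ‖π‖ ^ (j - i) * ‖π‖ ^ i := by rw [← pow_add]; congr 1; omega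
  rw [hjj, ← mul_assoc] at heq
  have h2 := mul_right_cancel₀ (pow_ne_zero _ hπ0) heq
  rw [eq_comm, ← eq_inv_mul_iff_mul_eq₀ hb0] at h2
  rw [h2]
  exact mul_mem_normSet (inv_mem_normSet (norm_mem_normSet hb)) (norm_mem_normSet ha)

/-- A sum of multiples of the powers of a generator is as large as its largest term. -/
theorem exists_norm_eq_sum_mul_pow [IsUltrametricDist L] {ℓ : ℕ} (hℓ : ℓ ≠ 0)
    {E : IntermediateField K L} {π : L} (hπE : ‖π‖ ∉ normSet E)
    (hπ : ∀ j, 0 < j → j < ℓ → ‖π‖ ^ j ∉ normSet E) {c : ℕ → L} (hc : ∀ i, c i ∈ E) :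
    ∃ k < ℓ, ‖∑ i ∈ Finset.range ℓ, c i * π ^ i‖ = ‖c k * π ^ k‖ ∧
      ∀ i < ℓ, ‖c i * π ^ i‖ ≤ ‖c k * π ^ k‖ := by
  obtain ⟨k, hk, hmax⟩ := Finset.exists_max_image (Finset.range ℓ) (fun i => ‖c i * π ^ i‖)
    ⟨0, Finset.mem_range.2 (Nat.pos_of_ne_zero hℓ)⟩
  have hkl := Finset.mem_range.1 hk
  refine ⟨k, hkl, ?_, fun i hi => hmax i (Finset.mem_range.2 hi)⟩
  have hπ0 : π ≠ 0 := ne_zero_of_norm_notMem hπE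
  by_cases hck : c k = 0
  · have h0 : ∀ i ∈ Finset.range ℓ, c i * π ^ i = 0 := fun i hi => by
      have := hmax i hi
      simp only [hck, zero_mul, norm_zero] at this
      exact norm_le_zero_iff.1 this
    rw [Finset.sum_eq_zero h0, h0 k hk]
  rw [← Finset.sum_erase_add _ _ hk]
  apply norm_eq_of_norm_sub_lt
  rw [add_sub_cancel_right]
  have hpos : 0 < ‖c k * π ^ k‖ := norm_pos_iff.2 (mul_ne_zero hck (pow_ne_zero _ hπ0))
  by_cases hne : (Finset.range ℓ).erase k = ∅
  · rwa [hne, Finset.sum_empty, norm_zero]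
  have hne' := Finset.nonempty_iff_ne_empty.2 hne
  obtain ⟨i, hi, hle⟩ := IsUltrametricDist.exists_norm_finsetSum_le ((Finset.range ℓ).erase k)
    (fun i => c i * π ^ i)
  refine hle.trans_lt ?_
  obtain ⟨hik, hil⟩ := Finset.mem_erase.1 (hi hne')
  refine lt_of_le_of_ne (hmax i hil) ?_
  rcases lt_or_gt_of_ne hik with hlt | hlt
  · by_cases hci : c i = 0
    · rw [hci, zero_mul, norm_zero]; exact hpos.ne
    · exact norm_mul_pow_ne hπE hπ (hc i) (hc k) hci hlt hkl
  · exact (norm_mul_pow_ne hπE hπ (hc k) (hc i) hck hlt (Finset.mem_range.1 hil)).symm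

namespace RamifiedStep

variable {ℓ : ℕ} {τ : Gal(L/K)} {E G : IntermediateField K L}

theorem norm_mul_pow_ne (h : RamifiedStep ℓ τ E G) {π : L} (hπ : π ∈ G) (hπE : ‖π‖ ∉ normSet E)
    {a b : L} (ha : a ∈ E) (hb : b ∈ E) (ha0 : a ≠ 0) {i j : ℕ} (hij : i < j) (hj : j < ℓ) :
    ‖a * π ^ i‖ ≠ ‖b * π ^ j‖ :=
  _root_.norm_mul_pow_ne hπE (h.norm_pow_notMem π hπ hπE) ha hb ha0 hij hj

theorem exists_norm_eq_sum [IsUltrametricDist L] (h : RamifiedStep ℓ τ E G) (hℓ : ℓ ≠ 0) {π : L}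
    (hπ : π ∈ G) (hπE : ‖π‖ ∉ normSet E) {c : ℕ → L} (hc : ∀ i, c i ∈ E) :
    ∃ k < ℓ, ‖∑ i ∈ Finset.range ℓ, c i * π ^ i‖ = ‖c k * π ^ k‖ ∧
      ∀ i < ℓ, ‖c i * π ^ i‖ ≤ ‖c k * π ^ k‖ :=
  exists_norm_eq_sum_mul_pow hℓ hπE (h.norm_pow_notMem π hπ hπE) hc

/-- The terms of an expansion in powers of `π` have distinct absolute values, so none exceeds the
sum; a bound on `E` and at `π` therefore passes to every term and then to the sum. -/
theorem norm_map_sub_le [IsUltrametricDist L] (h : RamifiedStep ℓ τ E G) (hℓ : ℓ ≠ 0)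
    {s : Gal(L/K)} (hs : ∀ x, ‖s x‖ = ‖x‖) {A : ℝ} (hA : 0 ≤ A)
    (hE : ∀ x ∈ E, ‖s x - x‖ ≤ A * ‖x‖) {π : L} (hπ : π ∈ G) (hπE : ‖π‖ ∉ normSet E)
    (hsπ : ‖s π - π‖ ≤ A * ‖π‖) : ∀ y ∈ G, ‖s y - y‖ ≤ A * ‖y‖ := by
  intro y hy
  obtain ⟨c, hc, hyc⟩ := h.span π hπ hπE y hy
  obtain ⟨k, -, hk, hmax⟩ := h.exists_norm_eq_sum hℓ hπ hπE hc
  rw [← hyc] at hk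
  have : s y - y = ∑ i ∈ Finset.range ℓ, (s (c i * π ^ i) - c i * π ^ i) := by
    rw [Finset.sum_sub_distrib, ← hyc, ← map_sum, ← hyc]
  rw [this]
  refine IsUltrametricDist.norm_sum_le_of_forall_le_of_nonneg (by positivity) fun i hi => ?_
  refine le_trans ?_ (mul_le_mul_of_nonneg_left
    ((hmax i (Finset.mem_range.1 hi)).trans hk.ge) hA)
  have h2 : s (c i * π ^ i) - c i * π ^ i
      = (s (c i) - c i) * s (π ^ i) + c i * (s (π ^ i) - π ^ i) := by
    rw [map_mul]; ring
  rw [h2, norm_mul (c i) (π ^ i)]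
  refine (IsUltrametricDist.norm_add_le_max _ _).trans (max_le ?_ ?_)
  · rw [norm_mul, hs, ← mul_assoc]
    exact mul_le_mul_of_nonneg_right (hE _ (hc i)) (norm_nonneg _)
  · rw [norm_mul]
    have := norm_map_pow_sub_pow_le s hs hA hsπ i
    nlinarith [mul_le_mul_of_nonneg_left this (norm_nonneg (c i))]

theorem exists_isBreak [IsUltrametricDist L] (h : RamifiedStep ℓ τ E G) (hℓ : ℓ ≠ 0)
    (hs : ∀ x, ‖τ x‖ = ‖x‖) : ∃ B, 0 < B ∧ B ≤ 1 ∧ IsBreak τ E G B := by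
  -- The ratio at any `π` with new absolute value dominates the ratios on all of `G`. Exchanging two
  -- such elements shows that the ratio is the same for all of them; this common value is the break.
  have key : ∀ π ∈ G, ‖π‖ ∉ normSet E → ∀ y ∈ G, ‖τ y - y‖ ≤ (‖τ π - π‖ / ‖π‖) * ‖y‖ :=
    fun π hπ hπE => by
      have hπ0 : 0 < ‖π‖ := norm_pos_iff.2 (ne_zero_of_norm_notMem hπE)
      refine h.norm_map_sub_le hℓ hs (by positivity) (fun x hx => ?_) hπ hπE ?_
      · rw [(h.map_eq_iff x (h.le hx)).2 hx, sub_self, norm_zero]; positivity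
      · rw [div_mul_cancel₀ _ hπ0.ne']
  obtain ⟨π, hπ, hπE⟩ := h.exists_gen
  have hπ0 : 0 < ‖π‖ := norm_pos_iff.2 (ne_zero_of_norm_notMem hπE)
  refine ⟨‖τ π - π‖ / ‖π‖, div_pos (norm_pos_iff.2 (sub_ne_zero.2 fun he => ?_)) hπ0, ?_,
    key π hπ hπE, fun y hy hyE => ?_⟩
  · exact hπE (norm_mem_normSet ((h.map_eq_iff π hπ).1 he))
  · rw [div_le_one hπ0]
    exact (norm_sub_le_max _ _).trans (by rw [hs, max_self])
  · have hy0 : 0 < ‖y‖ := norm_pos_iff.2 (ne_zero_of_norm_notMem hyE)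
    refine le_antisymm (key π hπ hπE y hy) ?_
    have := key y hy hyE π hπ
    rw [← div_le_iff₀ hπ0] at this
    rwa [← le_div_iff₀ hy0]

variable {B : ℝ}

/-- The operator `τ - 1` scales by exactly `B` as long as the absolute values met are not those of
`E`. The trace can then be measured exactly through its leading term `(τ - 1) ^ (ℓ - 1)`. -/
theorem norm_sub_one_pow_eq (h : RamifiedStep ℓ τ E G) (hB : IsBreak τ E G B) {x : L} (hx : x ∈ G)
    (k : ℕ) (hk : ∀ j < k, B ^ j * ‖x‖ ∉ normSet E) :
    ‖((galEnd τ - 1) ^ k) x‖ = B ^ k * ‖x‖ := by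
  induction k with
  | zero => simp
  | succ k ih =>
    have ih := ih fun j hj => hk j (by omega)
    rw [pow_succ', Module.End.mul_apply, galEnd_sub_one_apply,
      hB.norm_eq _ (sub_one_pow_mem h.map_mem k hx) (by rw [ih]; exact hk k (by omega)), ih,
      pow_succ']
    ring

theorem galTrace_mem_bot (h : RamifiedStep ℓ τ E G) {x : L} (hx : x ∈ G) :
    galTrace ℓ τ x ∈ E := by
  rw [← h.map_eq_iff _ (galTrace_mem h.map_mem ℓ hx), ← sub_eq_zero, ← galEnd_sub_one_apply,
    ← Module.End.mul_apply, sub_one_mul_galTrace, galEnd_sub_one_apply, h.pow_apply x hx, sub_self]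

theorem norm_galTrace_eq [IsUltrametricDist L] (h : RamifiedStep ℓ τ E G) (hℓ : ℓ.Prime)
    (hB : IsBreak τ E G B) (hB0 : 0 ≤ B) (hB1 : B ≤ 1) (hlB : ‖(ℓ : L)‖ < B ^ (ℓ - 1)) {x : L}
    (hx : x ∈ G) (hx0 : x ≠ 0) (hk : ∀ j < ℓ - 1, B ^ j * ‖x‖ ∉ normSet E) :
    ‖galTrace ℓ τ x‖ = B ^ (ℓ - 1) * ‖x‖ := by
  have h1 := norm_galTrace_sub_le hℓ h.map_mem hB0 hB1 hB.norm_le hx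
  have h2 := h.norm_sub_one_pow_eq hB hx (ℓ - 1) hk
  rw [← h2]
  refine norm_eq_of_norm_sub_lt (h1.trans_lt ?_)
  rw [h2]
  exact mul_lt_mul_of_pos_right hlB (norm_pos_iff.2 hx0)

/-- A wildly ramified step with small break: there is an optimal element of trace one. -/
theorem exists_galTrace_eq_one [IsUltrametricDist L] (h : RamifiedStep ℓ τ E G) (hℓ : ℓ.Prime)
    (hB : IsBreak τ E G B) (hB0 : 0 < B) (hB1 : B ≤ 1) (hlB : ‖(ℓ : L)‖ < B ^ (ℓ - 1)) :
    ∃ x ∈ G, galTrace ℓ τ x = 1 ∧ B ^ (ℓ - 1) * ‖x‖ = 1 := by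
  obtain ⟨π, hπ, hπE⟩ := h.exists_gen
  have hπ0 : π ≠ 0 := ne_zero_of_norm_notMem hπE
  -- If `B` were a value of `E`, all `B ^ j * ‖π‖` would be new, so the trace of `π` would have a
  -- new absolute value although it lies in `E`.
  have hBE : B ∉ normSet E := fun hBE => by
    have hj : ∀ j : ℕ, B ^ j * ‖π‖ ∉ normSet E := fun j =>
      notMem_normSet_mul (pow_mem_normSet hBE j) (pow_ne_zero _ hB0.ne') hπE
    apply hj (ℓ - 1)
    rw [← h.norm_galTrace_eq hℓ hB hB0.le hB1 hlB hπ hπ0 fun j _ => hj j]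
    exact norm_mem_normSet (h.galTrace_mem_bot hπ)
  have hbG : (τ π - π) / π ∈ G := div_mem (sub_mem (h.map_mem π hπ) hπ) hπ
  have hb : ‖(τ π - π) / π‖ = B := by
    rw [norm_div, hB.norm_eq π hπ hπE, mul_div_assoc, div_self (norm_ne_zero_iff.2 hπ0), mul_one]
  set b := (τ π - π) / π
  have hb0 : b ≠ 0 := norm_ne_zero_iff.1 (hb ▸ hB0.ne')
  -- The exponent makes the successive values `B ^ j * ‖x‖` equal to `B ^ (-(ℓ - 1 - j))`, all new
  -- for `j < ℓ - 1`. The trace then has absolute value one, and dividing by it gives trace one.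
  have hxG : (b ^ (ℓ - 1))⁻¹ ∈ G := inv_mem (pow_mem hbG _)
  have hx0 : (b ^ (ℓ - 1))⁻¹ ≠ 0 := inv_ne_zero (pow_ne_zero _ hb0)
  have hxn : ‖(b ^ (ℓ - 1))⁻¹‖ = (B ^ (ℓ - 1))⁻¹ := by rw [norm_inv, norm_pow, hb]
  have htr := h.norm_galTrace_eq hℓ hB hB0.le hB1 hlB hxG hx0 fun j hj hmem => by
    have hpow : B ^ (ℓ - 1) = B ^ (ℓ - 1 - j) * B ^ j := by rw [← pow_add]; congr 1; omega
    have : (B ^ j * ‖(b ^ (ℓ - 1))⁻¹‖)⁻¹ = B ^ (ℓ - 1 - j) := by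
      rw [hxn, hpow]
      have := pow_ne_zero j hB0.ne'
      have := pow_ne_zero (ℓ - 1 - j) hB0.ne'
      field_simp
    have h2 := inv_mem_normSet hmem
    rw [this, ← hb] at h2
    exact h.norm_pow_notMem b hbG (hb ▸ hBE) _ (by omega) (by omega) h2
  rw [hxn, mul_inv_cancel₀ (pow_ne_zero _ hB0.ne')] at htr
  set t := galTrace ℓ τ (b ^ (ℓ - 1))⁻¹ with ht
  have htE : t ∈ E := h.galTrace_mem_bot hxG
  have ht0 : t ≠ 0 := norm_ne_zero_iff.1 (htr ▸ one_ne_zero)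
  refine ⟨t⁻¹ * (b ^ (ℓ - 1))⁻¹, mul_mem (h.le (inv_mem htE)) hxG, ?_, ?_⟩
  · have hfix : ∀ j : ℕ, (τ ^ j) t⁻¹ = t⁻¹ := fun j => by
      induction j with
      | zero => rfl
      | succ j ih =>
        rw [pow_succ', AlgEquiv.mul_apply, ih]
        exact (h.map_eq_iff _ (h.le (inv_mem htE))).2 (inv_mem htE)
    rw [galTrace_apply]
    simp only [map_mul, hfix]
    rw [← Finset.mul_sum, ← galTrace_apply, ← ht, inv_mul_cancel₀ ht0]
  · rw [norm_mul, norm_inv, htr, hxn, inv_one, one_mul, mul_inv_cancel₀ (pow_ne_zero _ hB0.ne')]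

/-- An optimal primitive of an element of trace zero. -/
theorem exists_map_sub_eq_norm [IsUltrametricDist L] (h : RamifiedStep ℓ τ E G) (hℓ : ℓ ≠ 0)
    (hB : IsBreak τ E G B) {x z : L} (hx : x ∈ G) (hx1 : galTrace ℓ τ x = 1) (hz : z ∈ G)
    (hz0 : galTrace ℓ τ z = 0) : ∃ w ∈ G, τ w - w = z ∧ B * ‖w‖ = ‖z‖ := by
  obtain ⟨w₀, hw₀, hw₀z⟩ :=
    exists_map_sub_eq_of_galTrace_eq_zero h.map_mem hx hz (h.pow_apply x hx) hx1 hz0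
  obtain ⟨π, hπ, hπE⟩ := h.exists_gen
  obtain ⟨c, hc, hwc⟩ := h.span π hπ hπE w₀ hw₀
  -- A primitive matters only modulo `E`. With its component in `E` removed, its dominant term is
  -- some `c k * π ^ k` with `0 < k`, so its absolute value is new and the break inequality is an
  -- equality.
  set c' : ℕ → L := fun i => if i = 0 then 0 else c i with hc'
  have hc'E : ∀ i, c' i ∈ E := fun i => by
    rw [hc']; dsimp only; split_ifs
    exacts [E.zero_mem, hc i]
  have hw : w₀ - c 0 = ∑ i ∈ Finset.range ℓ, c' i * π ^ i := by
    obtain ⟨n, rfl⟩ := Nat.exists_eq_succ_of_ne_zero hℓ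
    rw [hwc, Finset.sum_range_succ', Finset.sum_range_succ']
    simp [hc']
  have hwz : τ (w₀ - c 0) - (w₀ - c 0) = z := by
    rw [map_sub, (h.map_eq_iff _ (h.le (hc 0))).2 (hc 0), ← hw₀z]; ring
  have hwG : w₀ - c 0 ∈ G := sub_mem hw₀ (h.le (hc 0))
  refine ⟨w₀ - c 0, hwG, hwz, ?_⟩
  by_cases hw0 : w₀ - c 0 = 0
  · rw [← hwz, hw0]; simp
  rw [← hwz, hB.norm_eq _ hwG]
  intro hmem
  obtain ⟨k, hk, hkn, -⟩ := h.exists_norm_eq_sum hℓ hπ hπE hc'E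
  rw [← hw] at hkn
  have hk0 : k ≠ 0 := by
    rintro rfl
    rw [show c' 0 = 0 from if_pos rfl, zero_mul, norm_zero, norm_eq_zero] at hkn
    exact hw0 hkn
  obtain ⟨d, hd, hdn⟩ := hmem
  have hdn : ‖d‖ = ‖w₀ - c 0‖ := hdn
  refine h.norm_mul_pow_ne hπ hπE (a := d) (b := c' k) hd (hc'E k) ?_ (Nat.pos_of_ne_zero hk0) hk ?_
  · rintro rfl
    rw [norm_zero, eq_comm, norm_eq_zero] at hdn
    exact hw0 hdn
  · rw [pow_zero, mul_one, hdn, hkn]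

end RamifiedStep
end Step

/-! ### Growth of the ramification breaks in a tower of two steps -/

section TwoSteps

variable {K L : Type*} [Field K] [NormedField L] [Algebra K L] [IsUltrametricDist L]

/-- A totally ramified step adds no residue classes: in the expansion of a unit, the terms with a
positive power of `π` cannot have absolute value one. -/
theorem RamifiedStep.exists_norm_sub_lt_one {ℓ : ℕ} {τ : Gal(L/K)} {E G : IntermediateField K L}
    (h : RamifiedStep ℓ τ E G) (hℓ : ℓ ≠ 0) {u : L} (hu : u ∈ G) (hu1 : ‖u‖ = 1) :
    ∃ c ∈ E, ‖u - c‖ < 1 := by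
  by_cases huE : u ∈ E
  · exact ⟨u, huE, by simp⟩
  obtain ⟨π, hπ, hπE⟩ := h.exists_gen
  obtain ⟨c, hc, huc⟩ := h.span π hπ hπE u hu
  set c' : ℕ → L := fun i => if i = 0 then 0 else c i with hc'
  have hc'E : ∀ i, c' i ∈ E := fun i => by
    rw [hc']; dsimp only; split_ifs
    exacts [E.zero_mem, hc i]
  have hw : u - c 0 = ∑ i ∈ Finset.range ℓ, c' i * π ^ i := by
    obtain ⟨n, rfl⟩ := Nat.exists_eq_succ_of_ne_zero hℓ
    rw [huc, Finset.sum_range_succ', Finset.sum_range_succ']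
    simp [hc']
  obtain ⟨k, hk, hkn, -⟩ := h.exists_norm_eq_sum hℓ hπ hπE hc'E
  obtain ⟨k', -, hkn', hmax'⟩ := h.exists_norm_eq_sum hℓ hπ hπE hc
  rw [← hw] at hkn
  rw [← huc, hu1] at hkn'
  refine ⟨c 0, hc 0, ?_⟩
  have hk0 : k ≠ 0 := by
    rintro rfl
    rw [show c' 0 = 0 from if_pos rfl, zero_mul, norm_zero, norm_eq_zero, sub_eq_zero] at hkn
    exact huE (hkn ▸ hc 0)
  rw [hkn, show c' k = c k from if_neg hk0]
  refine lt_of_le_of_ne (by rw [hkn']; exact hmax' k hk) fun h1 => ?_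
  refine h.norm_mul_pow_ne hπ hπE E.one_mem (hc k) one_ne_zero (Nat.pos_of_ne_zero hk0) hk ?_
  rw [h1, pow_zero, mul_one, norm_one]

/-- An automorphism of `ℓ`-power order acting on a line through a constant residue class acts
through the trivial class. -/
theorem norm_map_sub_lt_of_pow_eq {ℓ : ℕ} (hℓ : ℓ.Prime) (hl : ‖(ℓ : L)‖ < 1) {s : Gal(L/K)}
    (hs : ∀ x, ‖s x‖ = ‖x‖) {π c : L} (hπ : π ≠ 0) (hsc : s c = c) (hc : ‖s π / π - c‖ < 1) {m : ℕ}
    (hm : (s ^ ℓ ^ m) π = π) : ‖s π / π - 1‖ < 1 := by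
  have hu : ‖s π / π‖ = 1 := by
    rw [norm_div, hs, div_self (norm_ne_zero_iff.2 hπ)]
  have hc1 : ‖c‖ = 1 := by
    rw [← hu]
    refine norm_eq_of_norm_sub_lt ?_
    rwa [norm_sub_rev, hu]
  have key : ∀ j : ℕ, ‖(s ^ j) π / π - c ^ j‖ < 1 := fun j => by
    induction j with
    | zero => simp [hπ]
    | succ j ih =>
      have hsπ : s π ≠ 0 := by simpa using hπ
      have : (s ^ (j + 1)) π / π - c ^ (j + 1)
          = s ((s ^ j) π / π - c ^ j) * (s π / π) + c ^ j * (s π / π - c) := by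
        rw [map_sub, map_div₀, map_pow, hsc, pow_succ' s, AlgEquiv.mul_apply]
        field_simp
        ring
      rw [this]
      refine (IsUltrametricDist.norm_add_le_max _ _).trans_lt (max_lt ?_ ?_)
      · rwa [norm_mul, hs, hu, mul_one]
      · rwa [norm_mul, norm_pow, hc1, one_pow, one_mul]
  have h1 := key (ℓ ^ m)
  rw [hm, div_self hπ, norm_sub_rev] at h1
  have h2 := norm_sub_one_lt_of_norm_pow_sub_one_lt hℓ hl hc1 m h1
  have : s π / π - 1 = (s π / π - c) + (c - 1) := by ring
  rw [this]
  exact (IsUltrametricDist.norm_add_le_max _ _).trans_lt (max_lt hc h2)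

variable {ℓ : ℕ} {σ : Gal(L/K)} {F E G : IntermediateField K L} {B B' : ℝ}

/-- The element `h` is so nearly fixed by `τ` that the norm of `1 + h` can be replaced by `(1 + h) ^
ℓ`, whose distance to one is governed by `h ^ ℓ`, since `|ℓ| |h| < |h| ^ ℓ`. -/
theorem norm_prod_one_add_sub_one {τ : Gal(L/K)} (hℓ : ℓ.Prime) (hτ : ∀ x, ‖τ x‖ = ‖x‖) {h : L}
    (h0 : 0 < ‖h‖) (h1 : ‖h‖ < 1) (hlh : ‖(ℓ : L)‖ < ‖h‖ ^ (ℓ - 1))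
    (hτh : ‖τ h - h‖ ≤ ‖h‖ ^ (ℓ + 1)) :
    ‖∏ j ∈ Finset.range ℓ, (1 + (τ ^ j) h) - 1‖ = ‖h‖ ^ ℓ := by
  have hτn : ∀ (j : ℕ) (x : L), ‖(τ ^ j) x‖ = ‖x‖ := fun j x => by
    induction j with
    | zero => simp
    | succ j ih => rw [pow_succ', AlgEquiv.mul_apply, hτ, ih]
  have hj : ∀ j : ℕ, ‖(τ ^ j) h - h‖ ≤ ‖h‖ ^ (ℓ + 1) := fun j => by
    induction j with
    | zero => simp
    | succ j ih =>
      have : (τ ^ (j + 1)) h - h = τ ((τ ^ j) h - h) + (τ h - h) := by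
        rw [map_sub, pow_succ', AlgEquiv.mul_apply]; ring
      rw [this]
      exact (IsUltrametricDist.norm_add_le_max _ _).trans (max_le (by rwa [hτ]) hτh)
  have hle : ∀ x : L, ‖x‖ ≤ 1 → ‖1 + x‖ ≤ 1 := fun x hx =>
    (IsUltrametricDist.norm_add_le_max _ _).trans (by simp [hx])
  have hprod : ∀ n : ℕ, ‖∏ j ∈ Finset.range n, (1 + (τ ^ j) h) - (1 + h) ^ n‖ ≤ ‖h‖ ^ (ℓ + 1) :=
    fun n => by
      induction n with
      | zero => simp
      | succ n ih =>
        have : ∏ j ∈ Finset.range (n + 1), (1 + (τ ^ j) h) - (1 + h) ^ (n + 1)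
            = (∏ j ∈ Finset.range n, (1 + (τ ^ j) h) - (1 + h) ^ n) * (1 + (τ ^ n) h)
              + (1 + h) ^ n * ((τ ^ n) h - h) := by
          rw [Finset.prod_range_succ, pow_succ]; ring
        rw [this]
        refine (IsUltrametricDist.norm_add_le_max _ _).trans (max_le ?_ ?_)
        · rw [norm_mul]
          refine (mul_le_of_le_one_right (norm_nonneg _) (hle _ ?_)).trans ih
          rw [hτn]; exact h1.le
        · rw [norm_mul, norm_pow]
          exact (mul_le_of_le_one_left (norm_nonneg _)
            (pow_le_one₀ (norm_nonneg _) (hle _ h1.le))).trans (hj n)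
  rw [← norm_pow]
  apply norm_eq_of_norm_sub_lt
  have : ∏ j ∈ Finset.range ℓ, (1 + (τ ^ j) h) - 1 - h ^ ℓ
      = (∏ j ∈ Finset.range ℓ, (1 + (τ ^ j) h) - (1 + h) ^ ℓ) + ((1 + h) ^ ℓ - 1 - h ^ ℓ) := by ring
  rw [this, norm_pow]
  refine (IsUltrametricDist.norm_add_le_max _ _).trans_lt (max_lt ?_ ?_)
  · refine (hprod ℓ).trans_lt ?_
    rw [pow_succ]
    exact mul_lt_of_lt_one_right (pow_pos h0 _) h1
  · refine (norm_one_add_pow_prime_sub_le hℓ h1.le).trans_lt ?_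
    have := mul_lt_mul_of_pos_right hlh h0
    rwa [← pow_succ, Nat.sub_add_cancel hℓ.one_lt.le] at this

/-- Control of the action of a generator of the lower step on the upper field. -/
theorem exists_norm_map_sub_le (hℓ : ℓ.Prime) (hl : ‖(ℓ : L)‖ < 1)
    (hσ : ∀ (s : Gal(L/K)) (x : L), ‖s x‖ = ‖x‖) (h₁ : RamifiedStep ℓ σ F E)
    (h₂ : RamifiedStep ℓ (σ ^ ℓ) E G) (hσG : ∀ x ∈ G, σ x ∈ G) (hB0 : 0 ≤ B) (hB1 : B ≤ 1)
    (hB : IsBreak σ F E B) :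
    ∃ A : ℝ, 0 ≤ A ∧ A ≤ 1 ∧ (∀ y ∈ G, ‖σ y - y‖ ≤ A * ‖y‖) ∧
      (A ^ (ℓ - 1) ≤ ‖(ℓ : L)‖ ∨ A ^ ℓ ≤ B) := by
  obtain ⟨π, hπ, hπE⟩ := h₂.exists_gen
  have hπ0 : π ≠ 0 := ne_zero_of_norm_notMem hπE
  have hπn : 0 < ‖π‖ := norm_pos_iff.2 hπ0
  have hG : ∀ A : ℝ, 0 ≤ A → B ≤ A → ‖σ π / π - 1‖ ≤ A → ∀ y ∈ G, ‖σ y - y‖ ≤ A * ‖y‖ :=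
    fun A hA hBA hA' => by
      refine h₂.norm_map_sub_le hℓ.ne_zero (hσ σ) hA (fun x hx => (hB.norm_le x hx).trans
        (mul_le_mul_of_nonneg_right hBA (norm_nonneg _))) hπ hπE ?_
      rwa [div_sub_one hπ0, norm_div, div_le_iff₀ hπn] at hA'
  rcases le_or_gt ‖σ π / π - 1‖ B with hle | hlt
  · refine ⟨B, hB0, hB1, hG B hB0 le_rfl hle, Or.inr (pow_le_of_le_one hB0 hB1 hℓ.ne_zero)⟩
  have huG : σ π / π ∈ G := div_mem (hσG π hπ) hπ
  have hu1 : ‖σ π / π‖ = 1 := by rw [norm_div, hσ, div_self hπn.ne']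
  -- Both steps preserve residue classes, so `σ π / π` is congruent to an element of `F`, which `σ`
  -- fixes. Since `σ ^ ℓ ^ 2` fixes `π`, that class is trivial.
  have hlt1 : ‖σ π / π - 1‖ < 1 := by
    obtain ⟨c₁, hc₁, hc₁u⟩ := h₂.exists_norm_sub_lt_one hℓ.ne_zero huG hu1
    have hc₁1 : ‖c₁‖ = 1 := by
      rw [← hu1]
      refine norm_eq_of_norm_sub_lt ?_
      rwa [norm_sub_rev, hu1]
    obtain ⟨c, hc, hcu⟩ := h₁.exists_norm_sub_lt_one hℓ.ne_zero hc₁ hc₁1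
    refine norm_map_sub_lt_of_pow_eq hℓ hl (hσ σ) hπ0
      ((h₁.map_eq_iff c (h₁.le hc)).2 hc) (m := 2) ?_ ?_
    · have : σ π / π - c = (σ π / π - c₁) + (c₁ - c) := by ring
      rw [this]
      exact (IsUltrametricDist.norm_add_le_max _ _).trans_lt (max_lt hc₁u hcu)
    · rw [sq, pow_mul]; exact h₂.pow_apply π hπ
  set a := σ π / π - 1 with ha
  have ha0 : 0 < ‖a‖ := hB0.trans_lt hlt
  have hAG := hG ‖a‖ ha0.le hlt.le le_rfl
  refine ⟨‖a‖, ha0.le, hlt1.le, hAG, ?_⟩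
  rcases le_or_gt (‖a‖ ^ (ℓ - 1)) ‖(ℓ : L)‖ with hle | hgt
  · exact Or.inl hle
  right
  have haG : a ∈ G := sub_mem huG G.one_mem
  have hτa : ‖(σ ^ ℓ) a - a‖ ≤ ‖a‖ ^ (ℓ + 1) := by
    refine (norm_pow_map_sub_le hℓ hσG ha0.le hlt1.le hAG haG).trans (le_of_eq ?_)
    rw [max_eq_left hgt.le, pow_succ, ← mul_assoc, ← pow_succ, Nat.sub_add_cancel hℓ.one_lt.le]
  rw [← norm_prod_one_add_sub_one hℓ (hσ _) ha0 hlt1 hgt hτa]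
  -- The norm of `π` to `E`. The quotient `σ N / N` is the norm of `1 + a`, at distance `‖a‖ ^ ℓ`
  -- from one, whereas the break of `E / F` bounds this distance by `B`.
  set N := ∏ j ∈ Finset.range ℓ, ((σ ^ ℓ) ^ j) π with hN
  have hNG : N ∈ G := prod_mem fun j _ => pow_map_mem h₂.map_mem j hπ
  have hN0 : N ≠ 0 := Finset.prod_ne_zero_iff.2 fun j _ =>
    (map_ne_zero_iff _ (AlgEquiv.injective _)).2 hπ0
  have hNE : N ∈ E := by
    rw [← h₂.map_eq_iff N hNG, hN, map_prod]
    have e1 := Finset.prod_range_succ' (fun j => ((σ ^ ℓ) ^ j) π) ℓ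
    rw [Finset.prod_range_succ, h₂.pow_apply π hπ] at e1
    simp only [pow_zero, AlgEquiv.one_apply] at e1
    rw [mul_right_cancel₀ hπ0 e1]
    exact Finset.prod_congr rfl fun j _ => by rw [pow_succ', AlgEquiv.mul_apply]
  have hquot : ∏ j ∈ Finset.range ℓ, (1 + ((σ ^ ℓ) ^ j) a) = σ N / N := by
    rw [hN, map_prod, ← Finset.prod_div_distrib]
    refine Finset.prod_congr rfl fun j _ => ?_
    rw [ha, map_sub, map_one, add_sub_cancel, map_div₀]
    congr 1
    exact congrArg (fun g : Gal(L/K) => g π)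
      (((Commute.refl σ).pow_left ℓ).pow_left j).eq
  rw [hquot, div_sub_one hN0, norm_div, div_le_iff₀ (norm_pos_iff.2 hN0)]
  exact hB.norm_le N hNE

/-- Comparison of the breaks of two consecutive steps. -/
theorem break_succ_le (hℓ : ℓ.Prime) (hl : ‖(ℓ : L)‖ < 1)
    (hσ : ∀ (s : Gal(L/K)) (x : L), ‖s x‖ = ‖x‖) (h₁ : RamifiedStep ℓ σ F E)
    (h₂ : RamifiedStep ℓ (σ ^ ℓ) E G) (hσG : ∀ x ∈ G, σ x ∈ G) (hB0 : 0 ≤ B) (hB1 : B ≤ 1)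
    (hB : IsBreak σ F E B) (hB'0 : 0 < B') (hB'1 : B' ≤ 1) (hB' : IsBreak (σ ^ ℓ) E G B') :
    B' ^ (ℓ - 1) ≤ ‖(ℓ : L)‖ ∨ B' ^ ℓ ≤ ‖(ℓ : L)‖ * B ∨ B' ^ ℓ ≤ B ^ (ℓ * (ℓ - 1) + 1) := by
  -- Take `x` of trace one with `‖x‖ = B' ^ (-(ℓ - 1))`. The element `σ x - x` has trace zero, so it
  -- is `σ ^ ℓ w - w` with `w` small. With `N = w + σ w + ⋯ + σ ^ (ℓ - 1) w`, the difference `x - N`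
  -- is fixed by `σ`; taking its trace writes `1` as `ℓ x - ℓ N` plus the trace of `N`. The negated
  -- alternatives make all three terms smaller than one.
  by_contra! hcon
  obtain ⟨hP, hcon2, hcon3⟩ := hcon
  have hℓ1 : ℓ - 1 ≠ 0 := by have := hℓ.one_lt; omega
  have hB'l : ‖(ℓ : L)‖ < B' := hP.trans_le (pow_le_of_le_one hB'0.le hB'1 hℓ1)
  obtain ⟨A, hA0, hA1, hAG, hA⟩ := exists_norm_map_sub_le hℓ hl hσ h₁ h₂ hσG hB0 hB1 hB
  obtain ⟨x, hx, hx1, hxn⟩ := h₂.exists_galTrace_eq_one hℓ hB' hB'0 hB'1 hP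
  have hxpos : 0 < ‖x‖ := by
    rcases (norm_nonneg x).eq_or_lt with h | h
    · rw [← h, mul_zero] at hxn; exact absurd hxn zero_ne_one
    · exact h
  -- Otherwise `σ ^ ℓ` would move elements of `G` by a relative amount at most `‖ℓ‖ * A`, forcing
  -- `B' ≤ ‖ℓ‖`.
  have hAl : ‖(ℓ : L)‖ < A ^ (ℓ - 1) := by
    by_contra! hle
    obtain ⟨π, hπ, hπE⟩ := h₂.exists_gen
    have hπn : 0 < ‖π‖ := norm_pos_iff.2 (ne_zero_of_norm_notMem hπE)
    have e1 := norm_pow_map_sub_le hℓ hσG hA0 hA1 hAG hπ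
    rw [hB'.norm_eq π hπ hπE, max_eq_right hle, ← mul_assoc] at e1
    have e2 := le_of_mul_le_mul_right e1 hπn
    exact absurd (e2.trans (mul_le_of_le_one_right (norm_nonneg _) hA1)) (not_le.2 hB'l)
  have hAB : A ^ ℓ ≤ B := hA.resolve_left (not_le.2 hAl)
  have hcomm : Commute (σ ^ ℓ) σ := (Commute.refl σ).pow_left ℓ
  have hzG : σ x - x ∈ G := sub_mem (hσG x hx) hx
  have hz0 : galTrace ℓ (σ ^ ℓ) (σ x - x) = 0 := by
    rw [map_sub, galTrace_map_apply hcomm, hx1, map_one, sub_self]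
  obtain ⟨w, hw, hwz, hwn⟩ := h₂.exists_map_sub_eq_norm hℓ.ne_zero hB' hx hx1 hzG hz0
  have hwle : B' * ‖w‖ ≤ A * ‖x‖ := hwn.le.trans (hAG x hx)
  have hwP : B' * ‖w‖ * B' ^ (ℓ - 1) ≤ A := by
    calc B' * ‖w‖ * B' ^ (ℓ - 1) ≤ A * ‖x‖ * B' ^ (ℓ - 1) :=
          mul_le_mul_of_nonneg_right hwle (by positivity)
      _ = A := by rw [mul_assoc, mul_comm ‖x‖, hxn, mul_one]
  set N := galTrace ℓ σ w with hN
  have hNn : ‖N‖ ≤ A ^ (ℓ - 1) * ‖w‖ := by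
    have := norm_galTrace_le hℓ hσG hA0 hA1 hAG hw
    rwa [max_eq_left hAl.le] at this
  have hfix : σ (x - N) = x - N := by
    have : σ N - N = σ x - x := by
      rw [← galEnd_sub_one_apply, hN, ← Module.End.mul_apply, sub_one_mul_galTrace,
        galEnd_sub_one_apply, hwz]
    rw [map_sub]
    linear_combination -this
  have hfixp : ∀ j : ℕ, ((σ ^ ℓ) ^ j) (x - N) = x - N := fun j => by
    rw [← pow_mul]
    induction ℓ * j with
    | zero => rfl
    | succ k ih => rw [pow_succ', AlgEquiv.mul_apply, ih, hfix]
  have hsum : (1 : L) = (ℓ : L) * x - (ℓ : L) * N + galTrace ℓ (σ ^ ℓ) N := by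
    have e1 : galTrace ℓ (σ ^ ℓ) (x - N) = (ℓ : L) * (x - N) := by
      rw [galTrace_apply]
      simp only [hfixp, Finset.sum_const, Finset.card_range, nsmul_eq_mul]
    rw [map_sub, hx1] at e1
    linear_combination e1
  have hTr : ‖galTrace ℓ (σ ^ ℓ) N‖ ≤ max (B ^ (ℓ - 1)) ‖(ℓ : L)‖ * (B' ^ (ℓ - 1) * ‖w‖) := by
    -- The two trace operators commute. Taking the upper trace of `w` first lands in `E`, where the
    -- sharper bound by `B` applies to the lower trace.
    have e1 : galTrace ℓ (σ ^ ℓ) N = galTrace ℓ σ (galTrace ℓ (σ ^ ℓ) w) := by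
      rw [hN, galTrace_apply ℓ σ, galTrace_apply ℓ σ, map_sum]
      exact Finset.sum_congr rfl fun j _ => galTrace_map_apply (hcomm.pow_right j) ℓ w
    rw [e1]
    refine (norm_galTrace_le hℓ h₁.map_mem hB0 hB1 hB.norm_le (h₂.galTrace_mem_bot hw)).trans ?_
    refine mul_le_mul_of_nonneg_left ?_ (le_max_of_le_right (norm_nonneg _))
    have := norm_galTrace_le hℓ h₂.map_mem hB'0.le hB'1 hB'.norm_le hw
    rwa [max_eq_left hP.le] at this
  have hBpow : B' ^ ℓ = B' * B' ^ (ℓ - 1) := by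
    rw [← pow_succ', Nat.sub_add_cancel hℓ.one_lt.le]
  have hApow : A ^ (ℓ - 1) * A = A ^ ℓ := by
    rw [← pow_succ, Nat.sub_add_cancel hℓ.one_lt.le]
  have hone : 1 ≤ max (max (‖(ℓ : L)‖ * ‖x‖) (‖(ℓ : L)‖ * ‖N‖)) ‖galTrace ℓ (σ ^ ℓ) N‖ := by
    rw [← norm_one (α := L), hsum, ← norm_mul, ← norm_mul]
    exact (IsUltrametricDist.norm_add_le_max _ _).trans
      (max_le_max (norm_sub_le_max _ _) le_rfl)
  rcases le_max_iff.1 hone with h1 | h1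
  · rcases le_max_iff.1 h1 with h2 | h2
    · rw [← hxn] at h2
      exact absurd (le_of_mul_le_mul_right h2 hxpos) (not_le.2 hP)
    · have h3 : 1 ≤ ‖(ℓ : L)‖ * (A ^ (ℓ - 1) * ‖w‖) :=
        h2.trans (mul_le_mul_of_nonneg_left hNn (norm_nonneg _))
      refine absurd ?_ (not_le.2 hcon2)
      calc B' ^ ℓ ≤ B' ^ ℓ * (‖(ℓ : L)‖ * (A ^ (ℓ - 1) * ‖w‖)) :=
            le_mul_of_one_le_right (by positivity) h3
        _ = ‖(ℓ : L)‖ * (A ^ (ℓ - 1) * (B' * ‖w‖ * B' ^ (ℓ - 1))) := by rw [hBpow]; ring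
        _ ≤ ‖(ℓ : L)‖ * (A ^ (ℓ - 1) * A) := by gcongr
        _ ≤ ‖(ℓ : L)‖ * B := by rw [hApow]; gcongr
  · have h3 := h1.trans hTr
    have h4 : B' ≤ max (B ^ (ℓ - 1)) ‖(ℓ : L)‖ * A := by
      calc B' ≤ B' * (max (B ^ (ℓ - 1)) ‖(ℓ : L)‖ * (B' ^ (ℓ - 1) * ‖w‖)) :=
            le_mul_of_one_le_right hB'0.le h3
        _ = max (B ^ (ℓ - 1)) ‖(ℓ : L)‖ * (B' * ‖w‖ * B' ^ (ℓ - 1)) := by ring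
        _ ≤ _ := mul_le_mul_of_nonneg_left hwP (le_max_of_le_right (norm_nonneg _))
    rcases le_total (B ^ (ℓ - 1)) ‖(ℓ : L)‖ with h5 | h5
    · rw [max_eq_right h5] at h4
      exact absurd (h4.trans (mul_le_of_le_one_right (norm_nonneg _) hA1)) (not_le.2 hB'l)
    · rw [max_eq_left h5] at h4
      refine absurd ?_ (not_le.2 hcon3)
      calc B' ^ ℓ ≤ (B ^ (ℓ - 1) * A) ^ ℓ := pow_le_pow_left₀ hB'0.le h4 ℓ
        _ = B ^ (ℓ * (ℓ - 1)) * A ^ ℓ := by rw [mul_pow, ← pow_mul, mul_comm (ℓ - 1)]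
        _ ≤ B ^ (ℓ * (ℓ - 1)) * B := by gcongr
        _ = _ := (pow_succ _ _).symm

end TwoSteps

/-! ### Boundedness of the normalised traces -/

/-- A sequence of real numbers with the growth of ramification breaks stays away from one. -/
theorem exists_lt_one_forall_le_of_break_growth {n : ℕ} (hn : 0 < n) {b : ℕ → ℝ} {l : ℝ}
    (hl0 : 0 < l) (hl1 : l < 1) (hb0 : ∀ m, 0 < b m) (hb : b 0 < 1)
    (hrec : ∀ m, b (m + 1) ^ n ≤ l ∨ b (m + 1) ^ (n + 1) ≤ l * b m ∨
      b (m + 1) ^ (n + 1) ≤ b m ^ ((n + 1) * n + 1)) :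
    ∃ M, 0 < M ∧ M < 1 ∧ ∀ m, b m ≤ M := by
  have hn' : (0 : ℝ) < n := Nat.cast_pos.2 hn
  have hn1 : (1 : ℝ) ≤ n := Nat.one_le_cast.2 hn
  -- By Bernoulli, `1 - (1 - l) / n` is an explicit number below one whose `n`-th power is at least
  -- `l`; any larger `M < 1` that bounds `b 0` is preserved by all three alternatives.
  have hlM : l ≤ (1 - (1 - l) / n) ^ n := by
    have hle : (1 - l) / n ≤ 1 := by rw [div_le_one hn']; linarith
    have h := one_add_mul_le_pow (a := -((1 - l) / n)) (by linarith) n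
    rw [mul_neg, mul_div_cancel₀ _ hn'.ne'] at h
    rw [sub_eq_add_neg (1 : ℝ) ((1 - l) / n)]
    linarith
  have hpos : 0 < (1 - l) / n := div_pos (by linarith) hn'
  have hM1 : max (b 0) (1 - (1 - l) / n) < 1 := max_lt hb (by linarith)
  have hM0 : 0 < max (b 0) (1 - (1 - l) / n) := (hb0 0).trans_le (le_max_left _ _)
  have hnn : 0 ≤ 1 - (1 - l) / n := by
    have hle : (1 - l) / n ≤ 1 := by rw [div_le_one hn']; linarith
    linarith
  have hlM' : l ≤ max (b 0) (1 - (1 - l) / n) ^ n :=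
    hlM.trans (pow_le_pow_left₀ hnn (le_max_right _ _) n)
  refine ⟨max (b 0) (1 - (1 - l) / n), hM0, hM1, fun m => ?_⟩
  have hb0M : b 0 ≤ max (b 0) (1 - (1 - l) / n) := le_max_left _ _
  generalize max (b 0) (1 - (1 - l) / n) = M at hM0 hM1 hlM' hb0M
  induction m with
  | zero => exact hb0M
  | succ m ih =>
    by_contra! hlt
    have hlt' : M ^ (n + 1) < b (m + 1) ^ (n + 1) :=
      pow_lt_pow_left₀ hlt hM0.le (Nat.succ_ne_zero n)
    rcases hrec m with h | h | h
    · exact absurd (h.trans hlM') (not_le.2 (pow_lt_pow_left₀ hlt hM0.le hn.ne'))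
    · refine absurd (h.trans ?_) (not_le.2 hlt')
      rw [pow_succ]
      exact mul_le_mul hlM' ih (hb0 m).le (by positivity)
    · refine absurd (h.trans ?_) (not_le.2 hlt')
      refine (pow_le_pow_left₀ (hb0 m).le ih _).trans
        (pow_le_pow_of_le_one hM0.le hM1.le ?_)
      nlinarith

theorem sum_le_of_le_mul {d : ℕ → ℝ} {θ : ℝ} (hθ1 : θ < 1) (hd : ∀ m, 0 ≤ d m)
    (h : ∀ m, d (m + 1) ≤ θ * d m) (m : ℕ) : ∑ i ∈ Finset.range m, d i ≤ d 0 / (1 - θ) := by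
  have h1 : 0 < 1 - θ := by linarith
  rw [le_div_iff₀ h1]
  have key : (∑ i ∈ Finset.range m, d i) * (1 - θ) + d m ≤ d 0 := by
    induction m with
    | zero => simp
    | succ m ih =>
      rw [Finset.sum_range_succ]
      nlinarith [h m]
  linarith [hd m]

/-- After taking logarithms, the factors are exponentials of deficits `d m`, which decrease
geometrically. -/
theorem exists_prod_le_of_break_growth {n : ℕ} (hn : 0 < n) {b : ℕ → ℝ} {l : ℝ}
    (hl0 : 0 < l) (hl1 : l < 1) (hb0 : ∀ m, 0 < b m) (hb : b 0 < 1)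
    (hrec : ∀ m, b (m + 1) ^ n ≤ l ∨ b (m + 1) ^ (n + 1) ≤ l * b m ∨
      b (m + 1) ^ (n + 1) ≤ b m ^ ((n + 1) * n + 1)) :
    ∃ C, ∀ m, ∏ i ∈ Finset.range m, max 1 (b i ^ n / l) ≤ C := by
  obtain ⟨M, hM0, hM1, hM⟩ := exists_lt_one_forall_le_of_break_growth hn hl0 hl1 hb0 hb hrec
  set ε := -Real.log l with hε
  set β : ℕ → ℝ := fun m => -Real.log (b m) with hβ
  set δ := -Real.log M with hδ
  have hε0 : 0 < ε := neg_pos.2 (Real.log_neg hl0 hl1)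
  have hδ0 : 0 < δ := neg_pos.2 (Real.log_neg hM0 hM1)
  have hβδ : ∀ m, δ ≤ β m := fun m => neg_le_neg (Real.log_le_log (hb0 m) (hM m))
  set d : ℕ → ℝ := fun m => max 0 (ε - n * β m) with hd
  have hn1 : (1 : ℝ) ≤ n := Nat.one_le_cast.2 hn
  have hdε : ∀ m, d m ≤ ε := fun m => max_le hε0.le (by nlinarith [hβδ m])
  have hd0 : ∀ m, 0 ≤ d m := fun m => le_max_left _ _
  have hdle : ∀ m, ε - n * β m ≤ d m := fun m => le_max_right _ _
  have hrec' : ∀ m, ε ≤ n * β (m + 1) ∨ ε + β m ≤ (n + 1) * β (m + 1) ∨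
      ((n + 1) * n + 1) * β m ≤ (n + 1) * β (m + 1) := fun m => by
    have hp : ∀ k : ℕ, Real.log (b (m + 1) ^ k) = -(k * β (m + 1)) := fun k => by
      rw [Real.log_pow]; simp only [hβ]; ring
    rcases hrec m with h | h | h
    · left
      have := Real.log_le_log (pow_pos (hb0 _) _) h
      rw [hp] at this
      linarith
    · right; left
      have := Real.log_le_log (pow_pos (hb0 _) _) h
      rw [hp, Real.log_mul hl0.ne' (hb0 m).ne'] at this
      push_cast at this
      simp only [hβ] at this ⊢
      linarith
    · right; right
      have := Real.log_le_log (pow_pos (hb0 _) _) h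
      rw [hp, Real.log_pow] at this
      push_cast at this
      simp only [hβ] at this ⊢
      linarith
  -- The first alternative makes the next deficit zero. The second divides the deficit by at least
  -- `n + 1 ≥ 2`. The third lowers a positive deficit by at least `δ / 2`, which is a proportion `δ
  -- / (2 * ε)` at least, because deficits never exceed `ε`.
  set θ := max (1 / 2) (1 - δ / (2 * ε)) with hθ
  have hθ1 : θ < 1 := max_lt (by norm_num) (by
    have : 0 < δ / (2 * ε) := by positivity
    linarith)
  have hθ0 : 0 ≤ θ := le_max_of_le_left (by norm_num)
  have hstep : ∀ m, d (m + 1) ≤ θ * d m := fun m => by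
    refine max_le (mul_nonneg hθ0 (hd0 m)) ?_
    rcases hrec' m with h | h | h
    · exact (sub_nonpos.2 h).trans (mul_nonneg hθ0 (hd0 m))
    · refine le_trans ?_ (mul_le_mul_of_nonneg_right (le_max_left _ _) (hd0 m))
      rcases le_or_gt (ε - n * β (m + 1)) 0 with h0 | h0
      · linarith [hd0 m]
      · nlinarith [hdle m]
    · refine le_trans ?_ (mul_le_mul_of_nonneg_right (le_max_right _ _) (hd0 m))
      have h1 : n * β m + δ / 2 ≤ n * β (m + 1) := by
        have h2 : (0 : ℝ) < n + 1 := by linarith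
        have h3 : (n + 1) * (n * β m + β m / 2) ≤ (n + 1) * (n * β (m + 1)) := by
          have h4 := hδ0.trans_le (hβδ m)
          have h5 : (n + 1 : ℝ) * (n * β m + β m / 2) ≤ n * (((n + 1) * n + 1) * β m) := by
            have : (n + 1 : ℝ) * (n + 1 / 2) ≤ n * ((n + 1) * n + 1) := by
              nlinarith [mul_nonneg (sub_nonneg.2 hn1) (sub_nonneg.2 hn1),
                mul_nonneg (mul_nonneg (sub_nonneg.2 hn1) (sub_nonneg.2 hn1)) (sub_nonneg.2 hn1)]
            nlinarith
          nlinarith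
        have := le_of_mul_le_mul_left h3 h2
        linarith [hβδ m]
      have h2 : δ / (2 * ε) * d m ≤ δ / 2 := by
        calc δ / (2 * ε) * d m ≤ δ / (2 * ε) * ε :=
              mul_le_mul_of_nonneg_left (hdε m) (by positivity)
          _ = δ / 2 := by field_simp
      linarith [hdle m]
  refine ⟨Real.exp (d 0 / (1 - θ)), fun m => ?_⟩
  have hexp : ∀ i, max 1 (b i ^ n / l) = Real.exp (d i) := fun i => by
    simp only [hd]
    rw [Real.exp_monotone.map_max, Real.exp_zero]
    congr 1
    rw [hε, Real.exp_sub, Real.exp_neg, Real.exp_log hl0, ← neg_neg (n * β i), Real.exp_neg]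
    simp only [hβ]
    rw [mul_neg, neg_neg, ← Real.log_pow, Real.exp_log (pow_pos (hb0 i) n), div_inv_eq_mul,
      inv_mul_eq_div]
  rw [Finset.prod_congr rfl fun i _ => hexp i, ← Real.exp_sum]
  exact Real.exp_le_exp.2 (sum_le_of_le_mul hθ1 hd0 hstep m)

section Tower

variable {K L : Type*} [Field K] [NormedField L] [Algebra K L] [IsUltrametricDist L]
  {ℓ : ℕ} {γ : Gal(L/K)} {E : ℕ → IntermediateField K L}

theorem exists_galTrace_bound (hℓ : ℓ.Prime) (hl0 : 0 < ‖(ℓ : L)‖) (hl : ‖(ℓ : L)‖ < 1)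
    (hσ : ∀ (s : Gal(L/K)) (x : L), ‖s x‖ = ‖x‖) (hγ : ∀ m, ∀ x ∈ E m, γ x ∈ E m)
    (hE : ∀ m, RamifiedStep ℓ (γ ^ ℓ ^ m) (E m) (E (m + 1))) :
    ∃ D : ℕ → ℝ, (∀ m, 1 ≤ D m) ∧ (∃ C, ∀ m, ∏ i ∈ Finset.range m, D i ≤ C) ∧
      ∀ m, ∀ x ∈ E (m + 1), ‖galTrace ℓ (γ ^ ℓ ^ m) x‖ ≤ ‖(ℓ : L)‖ * D m * ‖x‖ := by
  choose b hb0 hb1 hb using fun m => (hE m).exists_isBreak hℓ.ne_zero (hσ _)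
  -- The residue class of `γ π / π` comes from the fixed field of the first step, and `γ ^ ℓ` fixes
  -- `π`; so this class is trivial.
  have hb00 : b 0 < 1 := by
    obtain ⟨π, hπ, hπE⟩ := (hE 0).exists_gen
    have hπ0 := ne_zero_of_norm_notMem hπE
    have hπn := norm_pos_iff.2 hπ0
    obtain ⟨c, hc, hcu⟩ := (hE 0).exists_norm_sub_lt_one hℓ.ne_zero
      (u := (γ ^ ℓ ^ 0) π / π) (div_mem ((hE 0).map_mem π hπ) hπ)
      (by rw [norm_div, hσ, div_self hπn.ne'])
    have := norm_map_sub_lt_of_pow_eq hℓ hl (hσ _) hπ0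
      (((hE 0).map_eq_iff c ((hE 0).le hc)).2 hc) hcu (m := 1)
      (by rw [pow_one]; exact (hE 0).pow_apply π hπ)
    rw [div_sub_one hπ0, norm_div, (hb 0).norm_eq π hπ hπE, mul_div_assoc, div_self hπn.ne',
      mul_one] at this
    exact this
  have hpowγ : ∀ k m, ∀ x ∈ E m, (γ ^ k) x ∈ E m := fun k m x hx => pow_map_mem (hγ m) k hx
  obtain ⟨n, rfl⟩ : ∃ n, ℓ = n + 1 := ⟨ℓ - 1, by have := hℓ.one_lt; omega⟩
  have hn : 0 < n := by have := hℓ.one_lt; omega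
  have hrec : ∀ m, b (m + 1) ^ n ≤ ‖((n + 1 : ℕ) : L)‖ ∨
      b (m + 1) ^ (n + 1) ≤ ‖((n + 1 : ℕ) : L)‖ * b m ∨
      b (m + 1) ^ (n + 1) ≤ b m ^ ((n + 1) * n + 1) := fun m => by
    have hpow : γ ^ (n + 1) ^ (m + 1) = (γ ^ (n + 1) ^ m) ^ (n + 1) := by
      rw [← pow_mul, ← pow_succ]
    have h2 := hE (m + 1)
    have hb2 := hb (m + 1)
    rw [hpow] at h2 hb2
    exact break_succ_le hℓ hl hσ (hE m) h2 (hpowγ _ _) (hb0 m).le (hb1 m) (hb m) (hb0 _) (hb1 _) hb2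
  refine ⟨fun m => max 1 (b m ^ n / ‖((n + 1 : ℕ) : L)‖), fun m => le_max_left _ _,
    exists_prod_le_of_break_growth hn hl0 hl hb0 hb00 hrec, fun m x hx => ?_⟩
  have := norm_galTrace_le hℓ (hE m).map_mem (hb0 m).le (hb1 m) (hb m).norm_le hx
  rw [Nat.add_sub_cancel, max_comm] at this
  rwa [mul_max_of_nonneg _ _ hl0.le, mul_one, mul_div_cancel₀ _ hl0.ne']

/-- The twisted operator `m γ ^ (ℓ ^ n) - 1` is bounded below on the union of the tower. -/
theorem exists_norm_le_mul_norm_twist_sub (hℓ : ℓ.Prime) (hl0 : 0 < ‖(ℓ : L)‖)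
    (hl : ‖(ℓ : L)‖ < 1)
    (hσ : ∀ (s : Gal(L/K)) (x : L), ‖s x‖ = ‖x‖) (hγ : ∀ m, ∀ x ∈ E m, γ x ∈ E m)
    (hE : ∀ m, RamifiedStep ℓ (γ ^ ℓ ^ m) (E m) (E (m + 1)))
    (hE' : ∀ m, ∀ x ∈ E m, (γ ^ ℓ ^ m) x = x) (n : ℕ) {μ : K}
    (hμ0 : algebraMap K L μ ≠ 1) (hμ : ‖algebraMap K L μ - 1‖ < ‖(ℓ : L)‖) :
    ∃ C, ∀ N, n ≤ N → ∀ x ∈ E N, ‖x‖ ≤ C * ‖algebraMap K L μ * (γ ^ ℓ ^ n) x - x‖ := by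
  obtain ⟨D, hD1, ⟨C, hC⟩, hD⟩ := exists_galTrace_bound hℓ hl0 hl hσ hγ hE
  set m := algebraMap K L μ with hm
  set s := γ ^ ℓ ^ n with hs
  have hm1 : ‖m‖ = 1 := by
    rw [← norm_one (α := L)]
    exact norm_eq_of_norm_sub_lt (by rw [norm_one]; exact hμ.trans hl)
  have hfix : ∀ t : Gal(L/K), ∀ k : ℕ, t (m ^ k) = m ^ k := fun t k => by
    rw [map_pow, hm, AlgEquiv.commutes]
  have hfix1 : ∀ t : Gal(L/K), t m = m := fun t => t.commutes μ
  have hmk : ∀ k : ℕ, ‖m ^ k - 1‖ ≤ ‖m - 1‖ := fun k => by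
    induction k with
    | zero => simp
    | succ k ih =>
      have : m ^ (k + 1) - 1 = m * (m ^ k - 1) + (m - 1) := by ring
      rw [this]
      refine (IsUltrametricDist.norm_add_le_max _ _).trans (max_le ?_ le_rfl)
      rwa [norm_mul, hm1, one_mul]
  have hSk : ∀ (k : ℕ) (y : L), ‖m ^ k * (s ^ k) y - y‖ ≤ ‖m * s y - y‖ := fun k y => by
    induction k with
    | zero => simp
    | succ k ih =>
      have : m ^ (k + 1) * (s ^ (k + 1)) y - y
          = m * s (m ^ k * (s ^ k) y - y) + (m * s y - y) := by
        rw [map_sub, map_mul, hfix, pow_succ' s, AlgEquiv.mul_apply]; ring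
      rw [this]
      refine (IsUltrametricDist.norm_add_le_max _ _).trans (max_le ?_ le_rfl)
      rwa [norm_mul, hm1, one_mul, hσ]
  set c₀ := max ‖m - 1‖⁻¹ ‖(ℓ : L)‖⁻¹ with hc₀
  have hm0 : 0 < ‖m - 1‖ := norm_pos_iff.2 (sub_ne_zero.2 hμ0)
  have hc₀0 : 0 ≤ c₀ := le_max_of_le_left (by positivity)
  have hprod1 : ∀ N, 1 ≤ ∏ i ∈ Finset.range N, D i := fun N => by
    induction N with
    | zero => simp
    | succ N ih => rw [Finset.prod_range_succ]; exact one_le_mul_of_one_le_of_one_le ih (hD1 N)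
  -- The constant is allowed to grow by `D N` at each layer; the products are bounded, so a uniform
  -- constant survives.
  suffices h : ∀ N, n ≤ N → ∀ x ∈ E N, ‖x‖ ≤ c₀ * (∏ i ∈ Finset.range N, D i) * ‖m * s x - x‖ from
    ⟨c₀ * C, fun N hN x hx => (h N hN x hx).trans (by gcongr; exact hC N)⟩
  intro N hN
  induction N, hN using Nat.le_induction with
  | base =>
    intro x hx
    rw [hs, hE' n x hx, ← sub_one_mul, norm_mul, ← mul_assoc]
    refine le_mul_of_one_le_left (norm_nonneg _) ?_
    calc (1 : ℝ) = ‖m - 1‖⁻¹ * 1 * ‖m - 1‖ := by field_simp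
      _ ≤ c₀ * (∏ i ∈ Finset.range n, D i) * ‖m - 1‖ := by
        gcongr
        · exact le_max_left _ _
        · exact hprod1 n
  | succ N hN ih =>
    intro x hx
    set τ := γ ^ ℓ ^ N with hτ
    have hτs : τ = s ^ ℓ ^ (N - n) := by
      rw [hτ, hs, ← pow_mul, ← pow_add, Nat.add_sub_cancel' hN]
    have hcomm : Commute τ s := by rw [hτs]; exact (Commute.refl s).pow_left _
    have hl0' : (ℓ : L) ≠ 0 := norm_pos_iff.1 hl0
    have hsx : m * s x - x ∈ E (N + 1) :=
      sub_mem (mul_mem ((E (N + 1)).algebraMap_mem μ) (pow_map_mem (hγ _) _ hx)) hx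
    set x' := galTrace ℓ τ x / (ℓ : L) with hx'
    have hx'E : x' ∈ E N := div_mem ((hE N).galTrace_mem_bot hx) (natCast_mem _ _)
    have hSx' : m * s x' - x' = galTrace ℓ τ (m * s x - x) / (ℓ : L) := by
      have : galTrace ℓ τ (m * s x) = m * s (galTrace ℓ τ x) := by
        rw [← galTrace_map_apply hcomm, galTrace_apply, galTrace_apply, Finset.mul_sum]
        exact Finset.sum_congr rfl fun j _ => by rw [map_mul, hfix1]
      rw [map_sub, this, hx', map_div₀, map_natCast]
      ring
    have hSx'n : ‖m * s x' - x'‖ ≤ D N * ‖m * s x - x‖ := by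
      rw [hSx', norm_div, div_le_iff₀ hl0]
      exact (hD N _ hsx).trans (le_of_eq (by ring))
    have hDN := hD1 N
    have hPN := hprod1 N
    rw [Finset.prod_range_succ]
    have h1 : ‖x'‖ ≤ c₀ * ((∏ i ∈ Finset.range N, D i) * D N) * ‖m * s x - x‖ := by
      refine (ih x' hx'E).trans ?_
      calc c₀ * (∏ i ∈ Finset.range N, D i) * ‖m * s x' - x'‖
          ≤ c₀ * (∏ i ∈ Finset.range N, D i) * (D N * ‖m * s x - x‖) := by gcongr
        _ = _ := by ring
    set y := x - x' with hy
    have hSy : ‖m * s y - y‖ ≤ D N * ‖m * s x - x‖ := by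
      have : m * s y - y = (m * s x - x) - (m * s x' - x') := by rw [hy, map_sub]; ring
      rw [this]
      exact (norm_sub_le_max _ _).trans
        (max_le (le_mul_of_one_le_left (norm_nonneg _) hDN) hSx'n)
    have hτx' : ∀ j : ℕ, (τ ^ j) x' = x' := fun j => by
      induction j with
      | zero => rfl
      | succ j ihj => rw [pow_succ', AlgEquiv.mul_apply, ihj]; exact hE' N x' hx'E
    have hTy : galTrace ℓ τ y = 0 := by
      have : galTrace ℓ τ x' = (ℓ : L) * x' := by
        rw [galTrace_apply]
        simp only [hτx', Finset.sum_const, Finset.card_range, nsmul_eq_mul]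
      rw [hy, map_sub, this, hx', mul_div_cancel₀ _ hl0', sub_self]
    have hτj : ∀ j : ℕ, ‖y - (τ ^ j) y‖ ≤ ‖τ y - y‖ := fun j => by
      induction j with
      | zero => simp
      | succ j ihj =>
        have : y - (τ ^ (j + 1)) y = τ (y - (τ ^ j) y) - (τ y - y) := by
          rw [map_sub τ y ((τ ^ j) y), pow_succ', AlgEquiv.mul_apply]; ring
        rw [this]
        exact (norm_sub_le_max _ _).trans (max_le (by rwa [hσ]) le_rfl)
    -- As `y` has trace zero, `ℓ y` is the sum of the differences `y - (τ ^ j) y`, each bounded by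
    -- `‖τ y - y‖`.
    have hly : ‖(ℓ : L)‖ * ‖y‖ ≤ ‖τ y - y‖ := by
      have : (ℓ : L) * y = ∑ j ∈ Finset.range ℓ, (y - (τ ^ j) y) := by
        rw [Finset.sum_sub_distrib, ← galTrace_apply, hTy, Finset.sum_const, Finset.card_range,
          nsmul_eq_mul, sub_zero]
      rw [← norm_mul, this]
      exact IsUltrametricDist.norm_sum_le_of_forall_le_of_nonneg (norm_nonneg _) fun j _ => hτj j
    have hτy : ‖τ y - y‖ ≤ max ‖m * s y - y‖ (‖m - 1‖ * ‖y‖) := by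
      set k := ℓ ^ (N - n)
      have : m ^ k * (τ y - y) = (m ^ k * (s ^ k) y - y) - (m ^ k - 1) * y := by rw [hτs]; ring
      have h2 : ‖τ y - y‖ = ‖m ^ k * (τ y - y)‖ := by rw [norm_mul, norm_pow, hm1, one_pow, one_mul]
      rw [h2, this]
      refine (norm_sub_le_max _ _).trans (max_le_max (hSk k y) ?_)
      rw [norm_mul]
      exact mul_le_mul_of_nonneg_right (hmk k) (norm_nonneg _)
    -- The hypothesis `‖m - 1‖ < ‖ℓ‖` excludes the second term of the maximum unless `y = 0`.
    have hyS : ‖(ℓ : L)‖ * ‖y‖ ≤ ‖m * s y - y‖ := by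
      rcases le_max_iff.1 (hly.trans hτy) with h | h
      · exact h
      · have : ‖y‖ = 0 := by
          by_contra hne
          have hpos : 0 < ‖y‖ := lt_of_le_of_ne (norm_nonneg _) (Ne.symm hne)
          exact absurd (le_of_mul_le_mul_right h hpos) (not_le.2 hμ)
        rw [this, mul_zero]
        exact norm_nonneg _
    have h2 : ‖y‖ ≤ c₀ * ((∏ i ∈ Finset.range N, D i) * D N) * ‖m * s x - x‖ := by
      calc ‖y‖ = ‖(ℓ : L)‖⁻¹ * 1 * (‖(ℓ : L)‖ * ‖y‖) := by field_simp
        _ ≤ c₀ * (∏ i ∈ Finset.range N, D i) * (D N * ‖m * s x - x‖) :=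
          mul_le_mul (mul_le_mul (le_max_right _ _) hPN zero_le_one hc₀0) (hyS.trans hSy)
            (by positivity) (by positivity)
        _ = _ := by ring
    have hxy : x = x' + y := by rw [hy]; ring
    calc ‖x‖ = ‖x' + y‖ := by rw [← hxy]
      _ ≤ max ‖x'‖ ‖y‖ := IsUltrametricDist.norm_add_le_max _ _
      _ ≤ _ := max_le h1 h2

end Tower

/-! ### The layers of a `ℤ_ℓ`-extension -/

section Layers

theorem pow_map_eq {K L : Type*} [Field K] [Field L] [Algebra K L] {s : Gal(L/K)} {x : L}
    (h : s x = x) (k : ℕ) : (s ^ k) x = x := by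
  induction k with
  | zero => rfl
  | succ k ih => rw [pow_succ', AlgEquiv.mul_apply, ih, h]

variable {K L : Type*} [Field K] [Field L] [Algebra K L] {ℓ : ℕ} [Fact ℓ.Prime]
  (φ : Gal(L/K) ≃ₜ* Multiplicative ℤ_[ℓ])

/-- The topological generator corresponding to `1 ∈ ℤ_ℓ`. -/
noncomputable def topGen : Gal(L/K) := φ.symm (Multiplicative.ofAdd 1)

theorem topGen_pow (k : ℕ) : topGen φ ^ k = φ.symm (Multiplicative.ofAdd (k : ℤ_[ℓ])) := by
  rw [topGen, ← map_pow, ← ofAdd_nsmul, nsmul_one]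

theorem denseRange_topGen_pow : DenseRange fun k : ℕ => topGen φ ^ k := by
  have h : (fun k : ℕ => topGen φ ^ k)
      = (φ.symm ∘ Multiplicative.ofAdd) ∘ (Nat.cast : ℕ → ℤ_[ℓ]) := funext (topGen_pow φ)
  rw [h]
  refine (φ.symm.surjective.comp Multiplicative.ofAdd.surjective).denseRange.comp
    PadicInt.denseRange_natCast ?_
  exact φ.symm.continuous.comp continuous_ofAdd

theorem tendsto_topGen_pow :
    Filter.Tendsto (fun m : ℕ => topGen φ ^ ℓ ^ m) Filter.atTop (nhds 1) := by
  have h : (fun m : ℕ => topGen φ ^ ℓ ^ m)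
      = (φ.symm ∘ Multiplicative.ofAdd) ∘ (fun m : ℕ => (ℓ : ℤ_[ℓ]) ^ m) := by
    funext m
    rw [topGen_pow]
    simp
  rw [h]
  have h1 : Filter.Tendsto (fun m : ℕ => (ℓ : ℤ_[ℓ]) ^ m) Filter.atTop (nhds 0) :=
    tendsto_pow_atTop_nhds_zero_of_norm_lt_one (PadicInt.norm_lt_one_iff_dvd _ |>.2 dvd_rfl)
  have h2 : Filter.Tendsto (φ.symm ∘ Multiplicative.ofAdd) (nhds (0 : ℤ_[ℓ])) (nhds 1) := by
    have hc : Continuous φ.symm := φ.symm.continuous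
    have := (hc.comp continuous_ofAdd).tendsto (0 : ℤ_[ℓ])
    rwa [Function.comp_apply, ofAdd_zero, map_one] at this
  exact h2.comp h1

/-- The subgroup of `Gal(L/K)` corresponding to `ℓ ^ m ℤ_ℓ`. -/
noncomputable def layerSubgroup (m : ℕ) : Subgroup Gal(L/K) :=
  ((PadicInt.toZModPow (p := ℓ) m).toAddMonoidHom.toMultiplicative.comp φ.toMonoidHom).ker

theorem mem_layerSubgroup {m : ℕ} {g : Gal(L/K)} :
    g ∈ layerSubgroup φ m ↔ (φ g).toAdd ∈ Ideal.span {(ℓ : ℤ_[ℓ]) ^ m} := by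
  rw [← PadicInt.ker_toZModPow, RingHom.mem_ker]
  exact MonoidHom.mem_ker

theorem index_layerSubgroup (m : ℕ) : (layerSubgroup φ m).index = ℓ ^ m := by
  have hs : Function.Surjective
      ((PadicInt.toZModPow (p := ℓ) m).toAddMonoidHom.toMultiplicative.comp φ.toMonoidHom) :=
    (ZMod.ringHom_surjective (PadicInt.toZModPow (p := ℓ) m)).comp φ.surjective
  rw [layerSubgroup, Subgroup.index_ker, MonoidHom.range_eq_top.2 hs, Subgroup.card_top]
  exact Nat.card_zmod _

theorem isClosed_layerSubgroup (m : ℕ) : IsClosed (layerSubgroup φ m : Set Gal(L/K)) := by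
  have : (layerSubgroup φ m : Set Gal(L/K))
      = (fun g => ‖(φ g).toAdd‖) ⁻¹' Set.Iic ((ℓ : ℝ) ^ (-(m : ℤ))) := by
    ext g
    rw [SetLike.mem_coe, mem_layerSubgroup, ← PadicInt.norm_le_pow_iff_mem_span_pow]
    rfl
  rw [this]
  exact isClosed_Iic.preimage (continuous_norm.comp (continuous_toAdd.comp φ.continuous))

/-- The `m`-th layer of a `ℤ_ℓ`-extension. -/
noncomputable def layer (m : ℕ) : IntermediateField K L := IntermediateField.fixedField (layerSubgroup φ m)

theorem finrank_layer [IsGalois K L] (m : ℕ) : Module.finrank K (layer φ m) = ℓ ^ m := by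
  rw [IntermediateField.finrank_eq_fixingSubgroup_index, layer,
    InfiniteGalois.fixingSubgroup_fixedField ⟨layerSubgroup φ m, isClosed_layerSubgroup φ m⟩]
  exact index_layerSubgroup φ m

/-- The stabiliser of `x` is the fixing subgroup of the finite extension generated by `x`. -/
theorem isOpen_setOf_map_eq [Algebra.IsAlgebraic K L] (x : L) :
    ∃ U : Subgroup Gal(L/K), IsOpen (U : Set Gal(L/K)) ∧ ∀ g, g ∈ U ↔ g x = x := by
  have hx : IsIntegral K x := (Algebra.IsAlgebraic.isAlgebraic x).isIntegral
  have := IntermediateField.adjoin.finiteDimensional hx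
  refine ⟨(IntermediateField.adjoin K {x}).fixingSubgroup,
    IntermediateField.fixingSubgroup_isOpen _, fun g => ?_⟩
  rw [IntermediateField.mem_fixingSubgroup_iff]
  refine ⟨fun h => h x (IntermediateField.mem_adjoin_simple_self K x), fun h y hy => ?_⟩
  have : IntermediateField.adjoin K {x} ≤ IntermediateField.fixedField (Subgroup.zpowers g) := by
    rw [IntermediateField.adjoin_simple_le_iff, IntermediateField.mem_fixedField_iff]
    intro f hf
    have : Subgroup.zpowers g ≤ MulAction.stabilizer Gal(L/K) x :=
      Subgroup.zpowers_le.2 (MulAction.mem_stabilizer_iff.2 h)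
    exact MulAction.mem_stabilizer_iff.1 (this hf)
  exact (IntermediateField.mem_fixedField_iff _ _).1 (this hy) g (Subgroup.mem_zpowers g)

/-- Stabilisers are open subgroups, hence closed, and the powers of `γ ^ ℓ ^ m` are dense in the
subgroup corresponding to `ℓ ^ m ℤ_ℓ`. -/
theorem mem_layer_iff [Algebra.IsAlgebraic K L] {m : ℕ} {x : L} :
    x ∈ layer φ m ↔ (topGen φ ^ ℓ ^ m) x = x := by
  rw [layer, IntermediateField.mem_fixedField_iff]
  constructor
  · intro h
    refine h _ ((mem_layerSubgroup φ).2 ?_)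
    rw [topGen_pow, ContinuousMulEquiv.apply_symm_apply, toAdd_ofAdd, Nat.cast_pow]
    exact Ideal.mem_span_singleton_self _
  · intro h g hg
    obtain ⟨a, ha⟩ := Ideal.mem_span_singleton'.1 ((mem_layerSubgroup φ).1 hg)
    obtain ⟨U, hU, hUx⟩ := isOpen_setOf_map_eq (K := K) x
    set f : ℤ_[ℓ] → Gal(L/K) := fun a => φ.symm (Multiplicative.ofAdd (a * (ℓ : ℤ_[ℓ]) ^ m)) with hf
    have hfc : Continuous f := φ.symm.continuous.comp (continuous_ofAdd.comp (by fun_prop))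
    have hcl : IsClosed (f ⁻¹' (U : Set Gal(L/K))) := (U.isClosed_of_isOpen hU).preimage hfc
    have hnat : ∀ a, f a ∈ U := by
      refine fun a => PadicInt.denseRange_natCast.induction_on a hcl fun k => ?_
      have : f k = (topGen φ ^ ℓ ^ m) ^ k := by
        rw [hf, ← pow_mul, topGen_pow, mul_comm (ℓ ^ m)]
        push_cast
        rfl
      rw [this]
      exact pow_mem ((hUx _).2 h) k
    have : g = f a := by
      rw [hf]
      dsimp only
      rw [ha, ofAdd_toAdd, ContinuousMulEquiv.symm_apply_apply]
    rw [this]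
    exact (hUx _).1 (hnat a)

theorem exists_mem_layer [Algebra.IsAlgebraic K L] (x : L) : ∃ m, x ∈ layer φ m := by
  obtain ⟨U, hU, hUx⟩ := isOpen_setOf_map_eq (K := K) x
  obtain ⟨m, hm⟩ := ((tendsto_topGen_pow φ).eventually (hU.mem_nhds U.one_mem)).exists
  exact ⟨m, (mem_layer_iff φ).2 ((hUx _).1 hm)⟩

theorem layer_mono [Algebra.IsAlgebraic K L] : Monotone (layer φ) := by
  refine monotone_nat_of_le_succ fun m x hx => ?_
  rw [mem_layer_iff] at hx ⊢
  rw [pow_succ, pow_mul]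
  exact pow_map_eq hx ℓ

end Layers

/-! ### Totally ramified towers -/

section Ram

variable {K L : Type*} [NormedField K] [NormedField L] [NormedAlgebra K L]

theorem norm_mem_normSet_iff {F : IntermediateField K L} {x : L} (hx : x ≠ 0) :
    ‖x‖ ∈ normSet F ↔ Units.mk0 ‖x‖ (norm_ne_zero_iff.2 hx) ∈ valueGroupOf K L F := by
  constructor
  · rintro ⟨y, hy, hyx⟩
    have hyx : ‖y‖ = ‖x‖ := hyx
    have hy0 : y ≠ 0 := norm_ne_zero_iff.1 (hyx ▸ norm_ne_zero_iff.2 hx)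
    refine ⟨Units.mk0 (⟨y, hy⟩ : F) (fun h => hy0 (congrArg Subtype.val h)), ?_⟩
    ext
    exact hyx
  · rintro ⟨u, hu⟩
    exact ⟨((u : F) : L), (u : F).2, congrArg Units.val hu⟩

theorem exists_norm_of_mem_valueGroupOf {F : IntermediateField K L} {r : ℝˣ}
    (hr : r ∈ valueGroupOf K L F) : ∃ x ∈ F, x ≠ 0 ∧ ‖x‖ = r := by
  obtain ⟨u, rfl⟩ := hr
  exact ⟨((u : F) : L), (u : F).2, fun h => u.ne_zero (Subtype.ext h), rfl⟩

theorem valueGroupOf_mono : Monotone (valueGroupOf K L) := by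
  intro F F' h r hr
  obtain ⟨x, hx, hx0, hxr⟩ := exists_norm_of_mem_valueGroupOf hr
  have := (norm_mem_normSet_iff (F := F') hx0).1 (norm_mem_normSet (h hx))
  convert this using 1
  ext
  exact hxr.symm

/-- The power `u ^ ℓ` always lies in `V`, and Bézout recovers `u` from `u ^ j` and `u ^ ℓ`. -/
theorem mem_of_pow_mem_of_relIndex_prime {A : Type*} [CommGroup A] {V W : Subgroup A} {ℓ : ℕ}
    (hℓ : ℓ.Prime) (h : V.relIndex W = ℓ) {u : A} (hu : u ∈ W) {j : ℕ} (hj0 : 0 < j)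
    (hjℓ : j < ℓ) (huj : u ^ j ∈ V) : u ∈ V := by
  have h1 : u ^ ℓ ∈ V := by
    have := (V.subgroupOf W).pow_index_mem ⟨u, hu⟩
    rw [← Subgroup.relIndex, h] at this
    exact this
  have hc : Nat.gcd j ℓ = 1 :=
    ((Nat.Prime.coprime_iff_not_dvd hℓ).2 (Nat.not_dvd_of_pos_of_lt hj0 hjℓ)).symm
  have h2 := Nat.gcd_eq_gcd_ab j ℓ
  rw [hc, Nat.cast_one] at h2
  rw [← zpow_one u, h2, zpow_add, zpow_mul, zpow_mul, zpow_natCast, zpow_natCast]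
  exact mul_mem (zpow_mem huj _) (zpow_mem h1 _)

variable {ℓ : ℕ}

/-- A generator by absolute value is a generator as soon as the degree does not exceed the number
of new absolute values. -/
theorem exists_eq_sum_mul_pow [IsUltrametricDist L] (hℓ : ℓ ≠ 0) {E G : IntermediateField K L}
    (hEG : E ≤ G) (hrank : E.relfinrank G = ℓ) {π : L} (hπG : π ∈ G) (hπE : ‖π‖ ∉ normSet E)
    (hπ : ∀ j, 0 < j → j < ℓ → ‖π‖ ^ j ∉ normSet E) {y : L} (hy : y ∈ G) :
    ∃ c : ℕ → L, (∀ i, c i ∈ E) ∧ y = ∑ i ∈ Finset.range ℓ, c i * π ^ i := by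
  rw [IntermediateField.relfinrank_eq_finrank_of_le hEG] at hrank
  set G' := IntermediateField.extendScalars hEG
  set p : G' := ⟨π, hπG⟩
  -- In a vanishing combination the largest term vanishes too, as the nonzero terms have distinct
  -- absolute values; comparison of dimensions then gives a basis.
  have hli : LinearIndependent E (fun i : Fin ℓ => p ^ (i : ℕ)) := by
    rw [Fintype.linearIndependent_iff]
    intro g hg i
    set c : ℕ → L := fun i => if h : i < ℓ then (g ⟨i, h⟩ : L) else 0 with hc
    have hcE : ∀ i, c i ∈ E := fun i => by
      rw [hc]; dsimp only; split_ifs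
      exacts [(g _).2, E.zero_mem]
    have hsum : ∑ i ∈ Finset.range ℓ, c i * π ^ i = 0 := by
      have h1 := congrArg (fun z : G' => (z : L)) hg
      simp only [AddSubmonoidClass.coe_finsetSum] at h1
      rw [Finset.sum_range]
      refine Eq.trans (Finset.sum_congr rfl fun i _ => ?_) h1
      rw [hc]
      simp only [Fin.is_lt, dite_true, Fin.eta]
      rfl
    obtain ⟨k, -, hk, hmax⟩ := exists_norm_eq_sum_mul_pow hℓ hπE hπ hcE
    rw [hsum, norm_zero] at hk
    have h2 := hmax i i.2
    rw [← hk] at h2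
    have h3 := norm_le_zero_iff.1 h2
    have h4 := (mul_eq_zero.1 h3).resolve_right (pow_ne_zero _ (ne_zero_of_norm_notMem hπE))
    rw [hc] at h4
    simp only [Fin.is_lt, dite_true, Fin.eta] at h4
    exact Subtype.ext h4
  have : FiniteDimensional E G' := Module.finite_of_finrank_pos
    (by rw [hrank]; exact Nat.pos_of_ne_zero hℓ)
  have hspan := hli.span_eq_top_of_card_eq_finrank' (by rw [Fintype.card_fin, hrank])
  have hmem : (⟨y, hy⟩ : G') ∈ Submodule.span E (Set.range fun i : Fin ℓ => p ^ (i : ℕ)) := by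
    rw [hspan]; trivial
  obtain ⟨g, hg⟩ := (Submodule.mem_span_range_iff_exists_fun E).1 hmem
  refine ⟨fun i => if h : i < ℓ then (g ⟨i, h⟩ : L) else 0, fun i => ?_, ?_⟩
  · dsimp only; split_ifs
    exacts [(g _).2, E.zero_mem]
  · have h1 := congrArg (fun z : G' => (z : L)) hg
    simp only [AddSubmonoidClass.coe_finsetSum] at h1
    rw [Finset.sum_range]
    refine Eq.trans h1.symm (Finset.sum_congr rfl fun i _ => ?_)
    simp only [Fin.is_lt, dite_true, Fin.eta]
    rfl

variable [Fact ℓ.Prime] [IsGalois K L] (φ : Gal(L/K) ≃ₜ* Multiplicative ℤ_[ℓ])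

theorem relIndex_valueGroupOf_layer (hram : IsTotRamified K L) (m : ℕ) :
    (valueGroupOf K L (layer φ m)).relIndex (valueGroupOf K L (layer φ (m + 1))) = ℓ := by
  have hℓ : ℓ.Prime := Fact.out
  have hfin : ∀ m, (valueGroupOf K L ⊥).relIndex (valueGroupOf K L (layer φ m)) = ℓ ^ m := fun m => by
    rw [← finrank_layer φ m]
    refine hram _ (Module.finite_of_finrank_pos ?_)
    rw [finrank_layer]
    exact pow_pos hℓ.pos m
  have h := Subgroup.relIndex_mul_relIndex (valueGroupOf K L ⊥) (valueGroupOf K L (layer φ m))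
    (valueGroupOf K L (layer φ (m + 1))) (valueGroupOf_mono bot_le)
    (valueGroupOf_mono (layer_mono φ m.le_succ))
  rw [hfin, hfin, pow_succ] at h
  exact Nat.eq_of_mul_eq_mul_left (pow_pos hℓ.pos m) h

theorem relfinrank_layer (m : ℕ) : (layer φ m).relfinrank (layer φ (m + 1)) = ℓ := by
  have hℓ : ℓ.Prime := Fact.out
  have h := IntermediateField.relfinrank_mul_relfinrank
    (bot_le : ⊥ ≤ layer φ m) (layer_mono φ m.le_succ)
  rw [IntermediateField.relfinrank_bot_left, IntermediateField.relfinrank_bot_left,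
    finrank_layer, finrank_layer, pow_succ] at h
  exact Nat.eq_of_mul_eq_mul_left (pow_pos hℓ.pos m) h

theorem map_mem_layer (m k : ℕ) : ∀ x ∈ layer φ m, (topGen φ ^ k) x ∈ layer φ m := fun x hx => by
  rw [mem_layer_iff] at hx ⊢
  rw [← AlgEquiv.mul_apply, (Commute.pow_pow_self (topGen φ) _ k).eq, AlgEquiv.mul_apply, hx]

/-- Consecutive layers of a totally ramified `ℤ_ℓ`-extension form totally ramified steps. -/
theorem ramifiedStep_layer [IsUltrametricDist L] (hram : IsTotRamified K L) (m : ℕ) :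
    RamifiedStep ℓ (topGen φ ^ ℓ ^ m) (layer φ m) (layer φ (m + 1)) := by
  have hℓ : ℓ.Prime := Fact.out
  have hidx := relIndex_valueGroupOf_layer φ hram m
  have hpow : ∀ x ∈ layer φ (m + 1), ‖x‖ ∉ normSet (layer φ m) → ∀ j, 0 < j → j < ℓ →
      ‖x‖ ^ j ∉ normSet (layer φ m) := fun x hx hxE j hj0 hjℓ hmem => by
    have hx0 := ne_zero_of_norm_notMem hxE
    refine hxE ((norm_mem_normSet_iff hx0).2 (mem_of_pow_mem_of_relIndex_prime hℓ hidx
      ((norm_mem_normSet_iff hx0).1 (norm_mem_normSet hx)) hj0 hjℓ ?_))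
    rw [← norm_pow, norm_mem_normSet_iff (pow_ne_zero j hx0)] at hmem
    convert hmem using 1
    ext
    simp
  refine ⟨layer_mono φ m.le_succ, fun x hx => ?_, map_mem_layer φ (m + 1) _,
    fun x _ => (mem_layer_iff φ).symm, ?_, hpow, fun π hπ hπE y hy => ?_⟩
  · rw [← pow_mul, ← pow_succ]
    exact (mem_layer_iff φ).1 hx
  · have hnot : ¬ valueGroupOf K L (layer φ (m + 1)) ≤ valueGroupOf K L (layer φ m) := fun hle => by
      rw [← Subgroup.relIndex_eq_one, hidx] at hle
      exact hℓ.ne_one hle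
    obtain ⟨r, hr, hr'⟩ := SetLike.not_le_iff_exists.1 hnot
    obtain ⟨x, hx, hx0, hxr⟩ := exists_norm_of_mem_valueGroupOf hr
    refine ⟨x, hx, fun hmem => hr' ?_⟩
    rw [norm_mem_normSet_iff hx0] at hmem
    convert hmem using 1
    ext
    exact hxr.symm
  · exact exists_eq_sum_mul_pow hℓ.ne_zero (layer_mono φ m.le_succ) (relfinrank_layer φ m) hπ hπE
      (hpow π hπ hπE) hy

end Ram

/-! ### The base field and the constant -/

section Base

variable {K : Type*} [NontriviallyNormedField K] [IsUltrametricDist K]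

theorem exists_uniformizer_norm [IsDiscreteValuationRing (Valued.integer K)] {ℓ e : ℕ}
    [CharP (Valued.ResidueField K) ℓ]
    (he : IsDiscreteValuationRing.addVal (Valued.integer K) (ℓ : Valued.integer K) = (e : ℕ∞)) :
    ∃ q : ℝ, 0 < q ∧ q < 1 ∧ ‖(ℓ : K)‖ = q ^ e ∧ ‖(ℓ : K)‖ < 1 ∧ ∀ x : K, ‖x‖ < 1 → ‖x‖ ≤ q := by
  obtain ⟨ϖ, hϖ⟩ := IsDiscreteValuationRing.exists_irreducible (Valued.integer K)
  have hmem : ∀ x : Valued.integer K, ‖x‖ < 1 ↔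
      x ∈ IsLocalRing.maximalIdeal (Valued.integer K) := fun x => by
    rw [IsLocalRing.mem_maximalIdeal, mem_nonunits_iff, Valued.integer.isUnit_iff_norm_eq_one]
    exact ⟨fun h => h.ne, fun h => lt_of_le_of_ne (Valued.integer.norm_le_one x) h⟩
  refine ⟨‖ϖ‖, Valued.integer.norm_irreducible_pos hϖ, Valued.integer.norm_irreducible_lt_one hϖ,
    ?_, ?_, fun x hx => ?_⟩
  · have hl0 : (ℓ : Valued.integer K) ≠ 0 := fun h0 => by
      rw [h0, IsDiscreteValuationRing.addVal_zero] at he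
      exact ENat.top_ne_natCast e he
    obtain ⟨n, u, hu⟩ := IsDiscreteValuationRing.eq_unit_mul_pow_irreducible hl0 hϖ
    rw [IsDiscreteValuationRing.addVal_def _ u hϖ n hu, Nat.cast_inj] at he
    have : ‖(ℓ : Valued.integer K)‖ = ‖ϖ‖ ^ e := by
      rw [hu, ← he]
      change ‖(((u : Valued.integer K) * ϖ ^ n : Valued.integer K) : K)‖ = _
      rw [Subring.coe_mul, Subring.coe_pow, norm_mul, norm_pow, Valued.integer.norm_coe_unit, one_mul]
      rfl
    rw [← this]
    rfl
  · have : ‖(ℓ : Valued.integer K)‖ < 1 := by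
      rw [hmem, ← IsLocalRing.residue_eq_zero_iff, map_natCast]
      exact CharP.cast_eq_zero (Valued.ResidueField K) ℓ
    exact this
  · have h1 := (hmem ⟨x, Valued.integer.mem_iff.2 hx.le⟩).1 hx
    rw [← SetLike.mem_coe, hϖ.maximalIdeal_eq_closedBall, mem_closedBall_zero_iff] at h1
    exact h1

end Base

/-- The logarithmic term of the constant alone gives `2 e < ℓ ^ (cSix ℓ e - 1)`; the two others are
nonnegative. -/
theorem le_pow_cSix_sub_one {ℓ e : ℕ} (hℓ : 2 ≤ ℓ) : e ≤ ℓ ^ (cSix ℓ e - 1) := by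
  rcases Nat.eq_zero_or_pos e with rfl | he
  · exact Nat.zero_le _
  have hl : (1 : ℝ) < ℓ := by exact_mod_cast hℓ
  have he' : (1 : ℝ) ≤ e := by exact_mod_cast he
  have hlog : 0 < Real.log ℓ := Real.log_pos hl
  set y := Real.log (2 * (e : ℝ)) / Real.log (ℓ : ℝ) with hy
  have h1 : y < (cSix ℓ e - 1 : ℕ) := by
    have h2 : y ≤ 1 / ((e : ℝ) * ℓ * ((ℓ : ℝ) - 1)) + 2 * (ℓ : ℝ) * e / ((ℓ : ℝ) - 1) ^ 2 + y := by
      have : 0 < (ℓ : ℝ) - 1 := by linarith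
      have : 0 ≤ 1 / ((e : ℝ) * ℓ * ((ℓ : ℝ) - 1)) := by positivity
      have : 0 ≤ 2 * (ℓ : ℝ) * e / ((ℓ : ℝ) - 1) ^ 2 := by positivity
      linarith
    refine h2.trans_lt ((Nat.lt_floor_add_one _).trans_le ?_)
    have : cSix ℓ e - 1 = ⌊1 / ((e : ℝ) * ℓ * ((ℓ : ℝ) - 1)) + 2 * (ℓ : ℝ) * e / ((ℓ : ℝ) - 1) ^ 2
        + y⌋₊ + 1 := by
      rw [cSix, hy]; omega
    rw [this]
    push_cast
    rfl
  have h3 : Real.log e < Real.log ((ℓ : ℝ) ^ (cSix ℓ e - 1)) := by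
    rw [Real.log_pow]
    rw [hy, div_lt_iff₀ hlog] at h1
    refine lt_of_le_of_lt (Real.log_le_log (by linarith) (by linarith)) h1
  have h4 := (Real.log_lt_log_iff (by linarith) (by positivity)).1 h3
  exact_mod_cast h4.le

theorem cSix_le {ℓ e : ℕ} (hℓ : 2 ≤ ℓ) (he : 1 ≤ e) : cSix ℓ e ≤ 7 * e := by
  have hl : (2 : ℝ) ≤ ℓ := by exact_mod_cast hℓ
  have he' : (1 : ℝ) ≤ e := by exact_mod_cast he
  have hlog2 : 0 < Real.log 2 := Real.log_pos (by norm_num)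
  have h1 : 1 / ((e : ℝ) * ℓ * ((ℓ : ℝ) - 1)) ≤ 1 / 2 := by
    apply one_div_le_one_div_of_le (by norm_num)
    nlinarith [mul_le_mul he' hl (by norm_num) (by linarith)]
  have h2 : 2 * (ℓ : ℝ) * e / ((ℓ : ℝ) - 1) ^ 2 ≤ 4 * e := by
    have : 0 < (ℓ : ℝ) - 1 := by linarith
    rw [div_le_iff₀ (by positivity)]
    have : 2 * (ℓ : ℝ) ≤ 4 * ((ℓ : ℝ) - 1) ^ 2 := by nlinarith
    nlinarith
  have h3 : Real.log (2 * (e : ℝ)) / Real.log (ℓ : ℝ) ≤ e := by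
    have hlog : 0 < Real.log ℓ := Real.log_pos (by linarith)
    rw [div_le_iff₀ hlog]
    have h4 : Real.log (2 * (e : ℝ)) ≤ e * Real.log 2 := by
      rw [← Real.log_pow]
      apply Real.log_le_log (by linarith)
      have h5 : ∀ n : ℕ, 1 ≤ n → 2 * n ≤ 2 ^ n := fun n hn => by
        induction n, hn using Nat.le_induction with
        | base => norm_num
        | succ n hn ih => rw [pow_succ]; omega
      exact_mod_cast h5 e he
    exact h4.trans (mul_le_mul_of_nonneg_left (Real.log_le_log (by norm_num) hl) (by linarith))
  -- The three terms are at most `1 / 2`, `4 e` and `e`, and `5 e + 1 / 2 < 7 e - 1` since `e ≥ 1`.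
  have h6 : ⌊1 / ((e : ℝ) * ℓ * ((ℓ : ℝ) - 1)) + 2 * (ℓ : ℝ) * e / ((ℓ : ℝ) - 1) ^ 2
    + Real.log (2 * (e : ℝ)) / Real.log (ℓ : ℝ)⌋₊ < 7 * e - 1 := by
    rw [Nat.floor_lt' (by omega), Nat.cast_sub (by omega)]
    push_cast
    linarith
  rw [cSix]
  omega

/-! ### Cohomology of the twisted completion -/

section Main

variable {K L : Type*} [NontriviallyNormedField K] [IsUltrametricDist K] [CompleteSpace K]
  [NormedField L] [NormedAlgebra K L] [Algebra.IsAlgebraic K L]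

variable (K) in
theorem norm_gal_apply (τ : Gal(L/K)) (x : L) : ‖τ x‖ = ‖x‖ := by
  rw [NormedAlgebra.norm_eq_spectralNorm K, NormedAlgebra.norm_eq_spectralNorm K,
    ← spectralNorm_eq_of_equiv τ x]

theorem isUltrametricDist_of_isAlgebraic (K L : Type*) [NontriviallyNormedField K]
    [IsUltrametricDist K] [CompleteSpace K] [NormedField L] [NormedAlgebra K L]
    [Algebra.IsAlgebraic K L] : IsUltrametricDist L :=
  IsUltrametricDist.isUltrametricDist_of_forall_norm_add_le_max_norm fun x y => by
    simp only [NormedAlgebra.norm_eq_spectralNorm K]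
    exact isNonarchimedean_spectralNorm x y

theorem norm_completionRep_apply (τ : Gal(L/K)) (x : UniformSpace.Completion L) :
    ‖completionRep K L τ x‖ = ‖x‖ := by
  induction x using UniformSpace.Completion.induction_on with
  | hp => exact isClosed_eq (continuous_completionRep K L τ).norm continuous_norm
  | ih x =>
    rw [completionRep_coe, UniformSpace.Completion.norm_coe, UniformSpace.Completion.norm_coe,
      norm_gal_apply]

/-- Orbit maps of elements of `L` are locally constant, and by isometry they approximate the orbit
map of `x` uniformly in `τ`. -/
theorem continuous_completionRep_orbit (x : UniformSpace.Completion L) :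
    Continuous fun τ : Gal(L/K) => completionRep K L τ x := by
  refine continuous_of_uniform_approx_of_continuous fun V hV => ?_
  obtain ⟨ε, hε, hεV⟩ := Metric.mem_uniformity_dist.1 hV
  obtain ⟨y, hy⟩ := UniformSpace.Completion.denseRange_coe.exists_dist_lt x hε
  refine ⟨fun τ : Gal(L/K) => ((τ y : L) : UniformSpace.Completion L), ?_, fun τ => hεV ?_⟩
  · refine (UniformSpace.Completion.continuous_coe L).comp (IsLocallyConstant.continuous ?_)
    rw [IsLocallyConstant.iff_eventually_eq]
    intro τ
    obtain ⟨U, hU, hUy⟩ := isOpen_setOf_map_eq (K := K) y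
    have hc : Continuous fun σ : Gal(L/K) => τ⁻¹ * σ := continuous_const.mul continuous_id
    filter_upwards [(hU.preimage hc).mem_nhds (show τ⁻¹ * τ ∈ U by simp)] with σ hσ
    have h1 := (hUy _).1 hσ
    have h2 : σ y = τ ((τ⁻¹ * σ) y) := by rw [← AlgEquiv.mul_apply, mul_inv_cancel_left]
    rw [h2, h1]
  · dsimp only
    rw [← completionRep_coe, dist_eq_norm, ← map_sub, norm_completionRep_apply, ← dist_eq_norm]
    exact hy

theorem twistRep_completionRep_coe (χ : Gal(L/K) →* Kˣ) (τ : Gal(L/K)) (x : L) :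
    twistRep (completionRep K L) χ τ (x : UniformSpace.Completion L)
      = ((algebraMap K L (χ τ) * τ x : L) : UniformSpace.Completion L) := by
  change (χ τ : K) • completionRep K L τ (x : UniformSpace.Completion L) = _
  rw [completionRep_coe, ← Algebra.smul_def, UniformSpace.Completion.coe_smul]

theorem continuous_twistRep_completionRep (χ : Gal(L/K) →* Kˣ) (τ : Gal(L/K)) :
    Continuous (twistRep (completionRep K L) χ τ) :=
  (continuous_completionRep K L τ).const_smul _

/-- An operator bounded below on an exhausting family of finite-dimensional stable subspaces
is bijective on the completion. -/
theorem bijective_twistRep_sub_one (χ : Gal(L/K) →* Kˣ) (τ : Gal(L/K))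
    (E : ℕ → IntermediateField K L) [∀ m, FiniteDimensional K (E m)] (hτ : ∀ m, ∀ x ∈ E m, τ x ∈ E m)
    {n : ℕ} (hE : ∀ x : L, ∃ m, n ≤ m ∧ x ∈ E m) {C : ℝ}
    (hC : ∀ m, n ≤ m → ∀ x ∈ E m, ‖x‖ ≤ C * ‖algebraMap K L (χ τ) * τ x - x‖) :
    Function.Bijective
      (twistRep (completionRep K L) χ τ - 1 : Module.End K (UniformSpace.Completion L)) := by
  set Q : Module.End K (UniformSpace.Completion L) :=
    twistRep (completionRep K L) χ τ - 1 with hQ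
  have hQc : Continuous Q := (continuous_twistRep_completionRep χ τ).sub continuous_id
  have hQx : ∀ x : L, Q (x : UniformSpace.Completion L)
      = ((algebraMap K L (χ τ) * τ x - x : L) : UniformSpace.Completion L) := fun x => by
    rw [hQ, LinearMap.sub_apply, twistRep_completionRep_coe, Module.End.one_apply,
      UniformSpace.Completion.coe_sub]
  have hle : ∀ x, ‖x‖ ≤ C * ‖Q x‖ := fun x => by
    induction x using UniformSpace.Completion.induction_on with
    | hp => exact isClosed_le continuous_norm (continuous_const.mul hQc.norm)
    | ih x =>
      obtain ⟨m, hnm, hx⟩ := hE x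
      rw [hQx, UniformSpace.Completion.norm_coe, UniformSpace.Completion.norm_coe]
      exact hC m hnm x hx
  have hle' : ∀ x, ‖x‖ ≤ (Real.toNNReal C : ℝ) * ‖Q x‖ := fun x =>
    (hle x).trans (mul_le_mul_of_nonneg_right (Real.le_coe_toNNReal C) (norm_nonneg _))
  -- The lower bound gives injectivity and a closed range. The range contains `L`, as an injective
  -- endomorphism of a finite-dimensional layer is onto, so it is dense.
  have hanti : AntilipschitzWith (Real.toNNReal C) Q :=
    AddMonoidHomClass.antilipschitz_of_bound Q hle'
  refine ⟨hanti.injective, ?_⟩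
  have hclosed : IsClosed (Set.range Q) :=
    hanti.isClosed_range (uniformContinuous_addMonoidHom_of_continuous hQc)
  rw [← Set.range_eq_univ, ← hclosed.closure_eq, ← dense_iff_closure_eq]
  refine UniformSpace.Completion.denseRange_coe.mono ?_
  rintro _ ⟨x, rfl⟩
  obtain ⟨m, hnm, hx⟩ := hE x
  set T : Module.End K L := (χ τ : K) • galEnd τ - 1 with hT
  have hTx : ∀ y, T y = algebraMap K L (χ τ) * τ y - y := fun y => by
    rw [← Algebra.smul_def]; rfl
  set V : Submodule K L := Subalgebra.toSubmodule (E m).toSubalgebra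
  have hTV : ∀ y ∈ V, T y ∈ V := fun y hy => by
    rw [hTx]
    exact (E m).sub_mem ((E m).mul_mem ((E m).algebraMap_mem _) (hτ m y hy)) hy
  have : FiniteDimensional K V := inferInstanceAs (FiniteDimensional K (E m))
  have hinj : Function.Injective (T.restrict hTV) := by
    rw [← LinearMap.ker_eq_bot, LinearMap.ker_eq_bot']
    intro y hy
    have h1 : T (y : L) = 0 := congrArg Subtype.val hy
    have h2 := hC m hnm y y.2
    rw [← hTx, h1, norm_zero, mul_zero] at h2
    exact Subtype.ext (norm_le_zero_iff.1 h2)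
  obtain ⟨y, hy⟩ := (LinearMap.injective_iff_surjective.1 hinj) ⟨x, hx⟩
  refine ⟨((y : L) : UniformSpace.Completion L), ?_⟩
  rw [hQx, ← hTx]
  exact congrArg (fun z : V => ((z : L) : UniformSpace.Completion L)) hy

theorem contH0_eq_bot_of_injective (χ : Gal(L/K) →* Kˣ) (γ : Gal(L/K))
    (h : Function.Injective
      (twistRep (completionRep K L) χ γ - 1 : Module.End K (UniformSpace.Completion L))) :
    contH0 (twistRep (completionRep K L) χ) = ⊥ := by
  rw [eq_bot_iff]
  intro x hx
  have h1 : twistRep (completionRep K L) χ γ x = x := hx γ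
  refine h ?_
  rw [map_zero, LinearMap.sub_apply, h1, Module.End.one_apply, sub_self]

/-- If `f γ` is the coboundary of `a` at `γ`, the cocycle relation gives agreement on all powers of
`γ`, and continuity extends it to the closure. -/
theorem subsingleton_contH1_of_surjective (χ : Gal(L/K) →ₜ* Kˣ) (γ : Gal(L/K))
    (hγ : DenseRange fun k : ℕ => γ ^ k)
    (h : Function.Surjective
      (twistRep (completionRep K L) χ.toMonoidHom γ - 1 : Module.End K (UniformSpace.Completion L))) :
    Subsingleton (contH1 (twistRep (completionRep K L) χ.toMonoidHom)) := by
  set ρ := twistRep (completionRep K L) χ.toMonoidHom with hρ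
  rw [Submodule.Quotient.subsingleton_iff, eq_top_iff]
  rintro ⟨f, hf, hfm⟩ -
  obtain ⟨a, ha⟩ := h (f γ)
  have ha' : ρ γ a - a = f γ := ha
  refine ⟨a, fun g => ?_⟩
  change f g = ρ g a - a
  have hcont : Continuous fun g : Gal(L/K) => ρ g a := by
    change Continuous fun g : Gal(L/K) => (χ g : K) • completionRep K L g a
    exact (Units.continuous_val.comp χ.continuous_toFun).smul (continuous_completionRep_orbit a)
  refine hγ.induction_on g (isClosed_eq hf (hcont.sub continuous_const)) fun k => ?_
  induction k with
  | zero =>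
    have h1 := hfm 1 1
    rw [mul_one, map_one, Module.End.one_apply, left_eq_add] at h1
    rw [pow_zero, h1, map_one, Module.End.one_apply, sub_self]
  | succ k ih =>
    rw [pow_succ', hfm, ih, ← ha', map_mul, Module.End.mul_apply, map_sub]
    abel

end Main

/-- The geometric sum is a cofactor of `R - 1` in `R ^ k - 1` on both sides; one order gives
injectivity, the other surjectivity. -/
theorem bijective_of_bijective_pow_sub_one {K V : Type*} [Field K] [AddCommGroup V] [Module K V]
    (R : Module.End K V) (k : ℕ) (h : Function.Bijective (R ^ k - 1 : Module.End K V)) :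
    Function.Bijective (R - 1 : Module.End K V) := by
  constructor
  · rw [← geom_sum_mul] at h
    exact Function.Injective.of_comp (f := (∑ i ∈ Finset.range k, R ^ i : Module.End K V)) h.1
  · rw [← mul_geom_sum] at h
    exact Function.Surjective.of_comp (g := (∑ i ∈ Finset.range k, R ^ i : Module.End K V)) h.2

theorem norm_units_sub_one_lt_one {K : Type*} [NormedField K] [IsUltrametricDist K] {ℓ : ℕ}
    (hℓ : ℓ.Prime) (hl : ‖(ℓ : K)‖ < 1) {u : Kˣ}
    (hu : Filter.Tendsto (fun m : ℕ => u ^ ℓ ^ m) Filter.atTop (nhds 1)) : ‖(u : K) - 1‖ < 1 := by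
  have h1 : Filter.Tendsto (fun m : ℕ => (u : K) ^ ℓ ^ m) Filter.atTop (nhds 1) := by
    have := (Units.continuous_val.tendsto (1 : Kˣ)).comp hu
    simpa [Function.comp_def] using this
  obtain ⟨m, hm⟩ := (h1.eventually (Metric.ball_mem_nhds 1 one_pos)).exists
  have hm : ‖(u : K) ^ ℓ ^ m - 1‖ < 1 := by
    rwa [← dist_eq_norm]
  refine norm_sub_one_lt_of_norm_pow_sub_one_lt hℓ hl ?_ m hm
  have h2 : ‖(u : K) ^ ℓ ^ m‖ = 1 := by
    rw [← norm_one (α := K)]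
    exact norm_eq_of_norm_sub_lt (by rwa [norm_one])
  rw [norm_pow] at h2
  exact (pow_eq_one_iff_of_nonneg (norm_nonneg _) (pow_ne_zero _ hℓ.ne_zero)).1 h2

theorem mainTheorem4 {K L : Type*} (ℓ e : ℕ) [Fact ℓ.Prime]
    -- `K` is complete for a discrete valuation, with perfect residue field of characteristic `ℓ`
    [NontriviallyNormedField K] [IsUltrametricDist K] [CompleteSpace K]
    [IsDiscreteValuationRing (Valued.integer K)]
    [CharP (Valued.ResidueField K) ℓ] [PerfectField (Valued.ResidueField K)]
    -- the ramification index `e = v(ℓ)`, for the normalised valuation `v`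
    (he : IsDiscreteValuationRing.addVal (Valued.integer K) (ℓ : Valued.integer K) = (e : ℕ∞))
    -- `L` carries the absolute value extending that of `K`
    [NormedField L] [NormedAlgebra K L] [IsGalois K L]
    (hram : IsTotRamified K L)
    (hgal : Nonempty (Gal(L/K) ≃ₜ* Multiplicative ℤ_[ℓ])) :
    cSix ℓ e ≤ 7 * e ∧
    ∀ χ : Gal(L/K) →ₜ* Kˣ, χ ^ (ℓ ^ cSix ℓ e) ≠ 1 →
      contH0 (twistRep (completionRep K L) χ.toMonoidHom) = ⊥ ∧
      Subsingleton (contH1 (twistRep (completionRep K L) χ.toMonoidHom)) := by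
  have hℓ : ℓ.Prime := Fact.out
  obtain ⟨q, hq0, hq1, hlq, hl1, hq⟩ := exists_uniformizer_norm he
  have he1 : 1 ≤ e := by
    rcases Nat.eq_zero_or_pos e with rfl | h
    · rw [pow_zero] at hlq; exact absurd hlq hl1.ne
    · exact h
  refine ⟨cSix_le hℓ.two_le he1, fun χ hχ => ?_⟩
  obtain ⟨φ⟩ := hgal
  have := isUltrametricDist_of_isAlgebraic K L
  have hl0 : 0 < ‖(ℓ : K)‖ := by rw [hlq]; positivity
  have hlL : ‖(ℓ : L)‖ = ‖(ℓ : K)‖ := by rw [← map_natCast (algebraMap K L), norm_algebraMap']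
  set n := cSix ℓ e with hn
  set γ := topGen φ with hγ
  set u : Kˣ := χ γ with hu
  have hu1 : ‖(u : K) - 1‖ < 1 := norm_units_sub_one_lt_one hℓ hl1 (by
    have := (χ.continuous_toFun.tendsto 1).comp (tendsto_topGen_pow φ)
    simpa [Function.comp_def] using this)
  -- Since `e ≤ ℓ ^ (n - 1)`, the first `n - 1` powers bring `u` within `‖ℓ‖ = q ^ e` of one; the
  -- last power makes the inequality strict.
  have hun : ‖(u : K) ^ ℓ ^ n - 1‖ < ‖(ℓ : K)‖ := by
    obtain ⟨k, hk⟩ : ∃ k, n = k + 1 := ⟨n - 1, by rw [hn, cSix]; omega⟩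
    have h1 := norm_pow_prime_pow_sub_one_le hℓ hq1.le (hq _ hu1) k
    have h2 : q ^ ℓ ^ k ≤ ‖(ℓ : K)‖ := by
      rw [hlq]
      refine pow_le_pow_of_le_one hq0.le hq1.le ?_
      have := le_pow_cSix_sub_one (e := e) hℓ.two_le
      rwa [← hn, hk, Nat.add_sub_cancel] at this
    rw [max_eq_right h2] at h1
    have h3 := norm_one_add_pow_prime_sub_le hℓ (h1.trans hl1.le)
    rw [add_sub_cancel, ← pow_mul, ← pow_succ, ← hk] at h3
    rw [← sub_add_cancel ((u : K) ^ ℓ ^ n - 1) (((u : K) ^ ℓ ^ k - 1) ^ ℓ)]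
    refine (IsUltrametricDist.norm_add_le_max _ _).trans_lt (max_lt (h3.trans_lt ?_) ?_)
    · exact mul_lt_of_lt_one_right hl0 (h1.trans_lt hl1)
    · rw [norm_pow]
      exact (pow_le_pow_left₀ (norm_nonneg _) h1 ℓ).trans_lt
        (pow_lt_self_of_lt_one₀ hl0 hl1 hℓ.one_lt)
  -- A continuous character trivial at the topological generator is trivial.
  have hune : u ^ ℓ ^ n ≠ 1 := fun h1 => hχ (by
    refine ContinuousMonoidHom.ext fun g => ?_
    refine (denseRange_topGen_pow φ).induction_on g
      (isClosed_eq (χ ^ ℓ ^ cSix ℓ e).continuous_toFun continuous_const) fun k => ?_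
    rw [map_pow, ContinuousMonoidHom.pow_apply, ← hγ, ← hu, h1, one_pow]
    rfl)
  have hfin : ∀ m, FiniteDimensional K (layer φ m) := fun m =>
    Module.finite_of_finrank_pos (by rw [finrank_layer]; exact pow_pos hℓ.pos m)
  have hμ : ((χ.toMonoidHom (γ ^ ℓ ^ n) : Kˣ) : K) = (u : K) ^ ℓ ^ n := by
    rw [map_pow, Units.val_pow_eq_pow_val]; rfl
  obtain ⟨C, hC⟩ := exists_norm_le_mul_norm_twist_sub (γ := γ) (E := layer φ) hℓ (hlL ▸ hl0)
    (hlL ▸ hl1) (norm_gal_apply K) (fun m x hx => by simpa using map_mem_layer φ m 1 x hx)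
    (ramifiedStep_layer φ hram) (fun m x hx => (mem_layer_iff φ).1 hx) n
    (μ := (χ.toMonoidHom (γ ^ ℓ ^ n) : Kˣ))
    (fun h1 => hune (Units.ext (by
      rw [← map_one (algebraMap K L), hμ] at h1
      simpa using (algebraMap K L).injective h1)))
    (by rwa [hlL, hμ, ← map_one (algebraMap K L), ← map_sub, norm_algebraMap'])
  have hbij : Function.Bijective
      (twistRep (completionRep K L) χ.toMonoidHom γ - 1 : Module.End K (UniformSpace.Completion L)) := by
    refine bijective_of_bijective_pow_sub_one _ (ℓ ^ n) ?_
    rw [← map_pow]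
    refine bijective_twistRep_sub_one _ _ (layer φ) (fun m => map_mem_layer φ m _) (n := n)
      (fun x => ?_) hC
    obtain ⟨m, hm⟩ := exists_mem_layer φ x
    exact ⟨max n m, le_max_left _ _, layer_mono φ (le_max_right _ _) hm⟩
  exact ⟨contH0_eq_bot_of_injective _ γ hbij.1,
    subsingleton_contH1_of_surjective χ γ (denseRange_topGen_pow φ) hbij.2⟩
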